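/- Let $d\ge 1$ and $n_1\ge n_2\ge\cdots\ge n_d\ge 2$ be integers, $\Omega=\prod_{i=1}^d[n_i]$ and $N=\prod_{i=1}^d n_i$. Write $\|p-q\|_{\mathrm{TV}}=\frac12\sum_{x\in\Omega}|p(x)-q(x)|$; a distribution on $\Omega$ is a product distribution if it has the form $x\mapsto\prod_{i=1}^d q_i(x_i)$ with $q_i$ a distribution on $[n_i]$, and $p$ is $\varepsilon$-far from product if $\|p-q\|_{\mathrm{TV}}\ge\varepsilon$ for every product distribution $q$ on $\Omega$. An $(\alpha,\varepsilon,\delta)$-augmented independence tester is a randomized algorithm that receives an explicit prediction $\hat p$ (a distribution on $\Omega$) and i.i.d. samples from an unknown distribution $p$ on $\Omega$, answers accept, reject or inaccurate information, and satisfies for all $p$ and $\hat p$: (i) if $\|p-\hat p\|_{\mathrm{TV}}\le\alpha$, it answers inaccurate information with probability at most $\delta/2$; (ii) if $p$ is $\varepsilon$-far from product, it answers accept with probability at most $\delta/2$; (iii) if $p$ is a product distribution, it answers reject with probability at most $\delta/2$. Theorem. There is an absolute constant $C$ such that for all $d$ and $n_1\ge\cdots\ge n_d\ge2$ as above, all $\varepsilon\in(0,1)$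 and all $\alpha\in[0,1]$, there is an $(\alpha,\varepsilon,0.1)$-augmented independence tester for distributions on $\prod_{i=1}^d[n_i]$ that uses at most $$C\cdot\max\left\{\frac{\sqrt N}{\varepsilon^2},\ \frac{n_1^{1/3}N^{1/3}\alpha^{1/3}}{\varepsilon^{4/3}}\right\}$$ samples. -/

import Mathlib

namespace AugIndep

/-- The three possible answers of an augmented tester. -/
inductive Answer
  | accept
  | reject
  | inaccurateInformation

/-- The product domain `[n₁] × ⋯ × [n_d]`. -/
abbrev Domain {d : ℕ} (n : Fin d → ℕ) : Type := (i : Fin d) → Fin (n i)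

/-- Total variation distance between two distributions on a finite set. -/
noncomputable def tvDist {Ω : Type*} [Fintype Ω] (p q : PMF Ω) : ℝ :=
  (1 / 2) * ∑ x, |(p x).toReal - (q x).toReal|

/-- `p` is a product distribution: its `d` coordinates are mutually independent. -/
def IsProduct {d : ℕ} {n : Fin d → ℕ} (p : PMF (Domain n)) : Prop :=
  ∃ q : (i : Fin d) → PMF (Fin (n i)), ∀ x, p x = ∏ i, q i (x i)

/-- `p` is at distance at least `ε` from every product distribution. -/
def IsFarFromProduct {d : ℕ} {n : Fin d → ℕ} (ε : ℝ) (p : PMF (Domain n)) : Prop :=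
  ∀ q : PMF (Domain n), IsProduct q → ε ≤ tvDist p q

/-- A randomized algorithm that knows a prediction explicitly and draws `m` samples: for every
prediction and every sequence of `m` observed samples, the distribution of its answer. -/
abbrev Tester (m : ℕ) (Ω : Type*) : Type _ := PMF Ω → (Fin m → Ω) → PMF Answer

/-- The probability that `A`, given the prediction `phat` and `m` independent samples from `p`,
answers `o` (over the samples and the internal randomness of `A`). -/
noncomputable def Tester.prob {m : ℕ} {Ω : Type*} [Fintype Ω] (A : Tester m Ω)
    (phat p : PMF Ω) (o : Answer) : ℝ :=
  ∑ s : Fin m → Ω, (∏ j, (p (s j)).toReal) * (A phat s o).toReal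

/-- `(α, ε, δ)`-augmented independence tester: for all (unknown) distributions `p` and all
(known, arbitrarily bad) predictions `phat`, each kind of wrong answer has probability
at most `δ / 2`. -/
structure IsAugmentedIndependenceTester {d m : ℕ} {n : Fin d → ℕ} (α ε δ : ℝ)
    (A : Tester m (Domain n)) : Prop where
  of_accurate : ∀ p phat : PMF (Domain n), tvDist p phat ≤ α →
    A.prob phat p Answer.inaccurateInformation ≤ δ / 2
  of_far : ∀ p phat : PMF (Domain n), IsFarFromProduct ε p →
    A.prob phat p Answer.accept ≤ δ / 2
  of_product : ∀ p phat : PMF (Domain n), IsProduct p →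
    A.prob phat p Answer.reject ≤ δ / 2

end AugIndep

/-!
Cut the coordinates at an index `k` into an initial block, a single coordinate and a final block,
so that both outer blocks have at most `√N` points. The outer marginals can then be learned within
the sample budget and compared directly with product distributions, so it remains to test whether
`p` equals the product of its three block marginals, from which samples can be drawn by recombining
the blocks of independent draws from `p`.

The latter is a closeness test whose cost is governed by the `ℓ²` norm of the product of the
marginals. Each marginal is therefore flattened: a point is split into buckets, their number being
determined by the prediction and by the multiplicity of the point in a batch of samples. For the
outer blocks the samples alone bring the norm down to the order of the uniform one. For the middle
coordinate, an `α`-accurate prediction brings it down to `2 / n k + α / m`; a norm estimate far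
above this value is evidence that the prediction is inaccurate.
-/

open MeasureTheory ProbabilityTheory
open scoped BigOperators

namespace AugIndep

section SampleMean

variable {U V ι κ : Type*} [MeasurableSpace U] [MeasurableSpace V] [Fintype ι] [Nonempty ι]
  [Fintype κ] [Nonempty κ] {μ : Measure U} [IsProbabilityMeasure μ] {ν : Measure V}
  [IsProbabilityMeasure ν]

lemma integral_expect_pi {g : U → ℝ} (hg : Integrable g μ) :
    ∫ s, 𝔼 i, g (s i) ∂Measure.pi (fun _ : ι => μ) = ∫ u, g u ∂μ := by
  simp only [Fintype.expect_eq_sum_div_card, integral_div]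
  rw [integral_finsetSum _ fun i _ => integrable_comp_eval hg,
    Finset.sum_congr rfl fun i _ => integral_comp_eval (i := i) hg.aestronglyMeasurable]
  simp

lemma variance_expect_pi {g : U → ℝ} (hg : MemLp g 2 μ) :
    Var[fun s => 𝔼 i, g (s i); Measure.pi fun _ : ι => μ] = Var[g; μ] / Fintype.card ι := by
  have hsum := variance_sum_pi (μ := fun _ : ι => μ) (X := fun _ => g) fun _ => hg
  simp only [Fintype.expect_eq_sum_div_card, div_eq_inv_mul, variance_const_mul]
  rw [show (fun s : ι → U => ∑ i, g (s i)) = ∑ i, fun s => g (s i) by ext; simp, hsum]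
  simp
  field_simp

lemma integral_expect_pi_sq_le {g : U → ℝ} (hg : MemLp g 2 μ) :
    ∫ s, (𝔼 i, g (s i)) ^ 2 ∂Measure.pi (fun _ : ι => μ) ≤
      (∫ u, g u ^ 2 ∂μ) / Fintype.card ι + (∫ u, g u ∂μ) ^ 2 := by
  have hmean : MemLp (fun s => 𝔼 i, g (s i)) 2 (Measure.pi fun _ : ι => μ) := by
    simp only [Fintype.expect_eq_sum_div_card, div_eq_inv_mul]
    exact (memLp_finsetSum _ fun i _ =>
      hg.comp_measurePreserving (measurePreserving_eval (fun _ : ι => μ) i)).const_mul _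
  have hvar := variance_expect_pi (ι := ι) hg
  rw [variance_eq_sub hmean, variance_eq_sub hg] at hvar
  simp only [Pi.pow_apply] at hvar
  rw [integral_expect_pi (hg.integrable one_le_two)] at hvar
  have : 0 ≤ (∫ u, g u ∂μ) ^ 2 / Fintype.card ι := by positivity
  rw [sub_div] at hvar
  linarith

variable [Finite U] [MeasurableSingletonClass U] [Finite V] [MeasurableSingletonClass V]

lemma integral_expect_expect (h : U → V → ℝ) :
    ∫ p, 𝔼 i, 𝔼 j, h (p.1 i) (p.2 j) ∂(Measure.pi fun _ : ι => μ).prod (Measure.pi fun _ : κ => ν) =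
      ∫ u, ∫ v, h u v ∂ν ∂μ := by
  calc _ = ∫ t, ∫ u, 𝔼 j, h u (t j) ∂μ ∂Measure.pi fun _ : κ => ν := by
        rw [integral_prod_symm _ .of_finite]
        exact integral_congr_ae (.of_forall fun t =>
          integral_expect_pi (g := fun u => 𝔼 j, h u (t j)) .of_finite)
    _ = ∫ u, ∫ t, 𝔼 j, h u (t j) ∂Measure.pi (fun _ : κ => ν) ∂μ :=
        integral_integral_swap .of_finite
    _ = _ := by simp_rw [fun u => integral_expect_pi (ι := κ) (μ := ν) (g := h u) .of_finite]

lemma integral_expect_expect_sq_le (h : U → V → ℝ) :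
    ∫ p, (𝔼 i, 𝔼 j, h (p.1 i) (p.2 j)) ^ 2
        ∂(Measure.pi fun _ : ι => μ).prod (Measure.pi fun _ : κ => ν) ≤
      (∫ u, (∫ v, h u v ∂ν) ^ 2 ∂μ) / Fintype.card ι +
        (∫ v, (∫ u, h u v ∂μ) ^ 2 ∂ν) / Fintype.card κ +
        (∫ u, ∫ v, h u v ^ 2 ∂ν ∂μ) / (Fintype.card ι * Fintype.card κ) +
        (∫ u, ∫ v, h u v ∂ν ∂μ) ^ 2 := by
  have hleft (t : κ → V) : ∫ s, (𝔼 i, 𝔼 j, h (s i) (t j)) ^ 2 ∂Measure.pi (fun _ : ι => μ) ≤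
      (∫ u, (𝔼 j, h u (t j)) ^ 2 ∂μ) / Fintype.card ι + (𝔼 j, ∫ u, h u (t j) ∂μ) ^ 2 := by
    refine (integral_expect_pi_sq_le (g := fun u => 𝔼 j, h u (t j)) .of_discrete).trans_eq ?_
    simp only [Fintype.expect_eq_sum_div_card, integral_div]
    rw [integral_finsetSum _ fun _ _ => .of_finite]
  have hright : ∫ t, (𝔼 j, ∫ u, h u (t j) ∂μ) ^ 2 ∂Measure.pi (fun _ : κ => ν) ≤
      (∫ v, (∫ u, h u v ∂μ) ^ 2 ∂ν) / Fintype.card κ + (∫ v, ∫ u, h u v ∂μ ∂ν) ^ 2 :=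
    integral_expect_pi_sq_le (g := fun v => ∫ u, h u v ∂μ) .of_discrete
  have hinner (u : U) : ∫ t, (𝔼 j, h u (t j)) ^ 2 ∂Measure.pi (fun _ : κ => ν) ≤
      (∫ v, h u v ^ 2 ∂ν) / Fintype.card κ + (∫ v, h u v ∂ν) ^ 2 :=
    integral_expect_pi_sq_le .of_discrete
  calc _ = ∫ t, ∫ s, (𝔼 i, 𝔼 j, h (s i) (t j)) ^ 2 ∂Measure.pi (fun _ : ι => μ)
            ∂Measure.pi fun _ : κ => ν := integral_prod_symm _ .of_finite
    _ ≤ ∫ t, ((∫ u, (𝔼 j, h u (t j)) ^ 2 ∂μ) / Fintype.card ι + (𝔼 j, ∫ u, h u (t j) ∂μ) ^ 2)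
            ∂Measure.pi fun _ : κ => ν := integral_mono .of_finite .of_finite hleft
    _ = (∫ u, ∫ t, (𝔼 j, h u (t j)) ^ 2 ∂Measure.pi (fun _ : κ => ν) ∂μ) / Fintype.card ι +
          ∫ t, (𝔼 j, ∫ u, h u (t j) ∂μ) ^ 2 ∂Measure.pi (fun _ : κ => ν) := by
        rw [integral_add .of_finite .of_finite, integral_div,
          integral_integral_swap .of_finite]
    _ ≤ (∫ u, ((∫ v, h u v ^ 2 ∂ν) / Fintype.card κ + (∫ v, h u v ∂ν) ^ 2) ∂μ) / Fintype.card ι +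
          ((∫ v, (∫ u, h u v ∂μ) ^ 2 ∂ν) / Fintype.card κ + (∫ v, ∫ u, h u v ∂μ ∂ν) ^ 2) := by
        gcongr
        exacts [.of_finite, .of_finite, hinner]
    _ = _ := by
        rw [integral_add .of_finite .of_finite, integral_div,
          integral_integral_swap (f := fun v u => h u v) .of_finite]
        ring

lemma variance_expect_expect_le (h : U → V → ℝ) :
    Var[fun p => 𝔼 i, 𝔼 j, h (p.1 i) (p.2 j);
        (Measure.pi fun _ : ι => μ).prod (Measure.pi fun _ : κ => ν)] ≤
      (∫ u, (∫ v, h u v ∂ν) ^ 2 ∂μ) / Fintype.card ι +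
        (∫ v, (∫ u, h u v ∂μ) ^ 2 ∂ν) / Fintype.card κ +
        (∫ u, ∫ v, h u v ^ 2 ∂ν ∂μ) / (Fintype.card ι * Fintype.card κ) := by
  rw [variance_eq_sub .of_discrete, integral_expect_expect, sub_le_iff_le_add]
  exact integral_expect_expect_sq_le h

end SampleMean

section CrossStat

variable {U Z ι κ : Type*} [Fintype Z] [Fintype ι] [Fintype κ]

/-- The inner product, weighted by `w`, of the mean feature vectors of two samples. For independent
samples from one law it is an unbiased estimate of the squared weighted norm of the expected feature
vector. -/
noncomputable def crossStat (w : Z → ℝ) (φ : U → Z → ℝ) (s : (ι → U) × (κ → U)) : ℝ :=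
  ∑ z, w z * (𝔼 i, φ (s.1 i) z) * (𝔼 j, φ (s.2 j) z)

lemma crossStat_eq_expect (w : Z → ℝ) (φ : U → Z → ℝ) (s : (ι → U) × (κ → U)) :
    crossStat w φ s = 𝔼 i, 𝔼 j, ∑ z, w z * φ (s.1 i) z * φ (s.2 j) z := by
  simp only [crossStat, Finset.expect_sum_comm, Finset.mul_expect, Finset.expect_mul]
  exact Finset.sum_congr rfl fun z _ => Finset.expect_comm _ _ _

variable {w : Z → ℝ} {φ : U → Z → ℝ} {k δ : ℝ}

lemma weight_mul_le {A : Z → ℝ} (hw₀ : ∀ z, 0 ≤ w z) (hw₁ : ∀ z, w z ≤ 1) (hδ : 0 ≤ δ)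
    (hA : ∑ z, w z * A z ^ 2 ≤ δ ^ 2) (z : Z) : w z * A z ≤ δ := by
  have hterm (z : Z) : 0 ≤ w z * A z ^ 2 := mul_nonneg (hw₀ z) (sq_nonneg _)
  refine (abs_le_of_sq_le_sq' ?_ hδ).2
  calc (w z * A z) ^ 2 = w z * (w z * A z ^ 2) := by ring
    _ ≤ w z * A z ^ 2 := mul_le_of_le_one_left (hterm z) (hw₁ z)
    _ ≤ _ := (Finset.single_le_sum (fun z _ => hterm z) (Finset.mem_univ z)).trans hA

lemma sq_sum_weighted_mul_le (hφ : ∀ u, ∑ z, |φ u z| ≤ k) (x : Z → ℝ) (u : U) :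
    (∑ z, φ u z * x z) ^ 2 ≤ k * ∑ z, |φ u z| * x z ^ 2 := by
  calc _ ≤ (∑ z, |φ u z|) * ∑ z, |φ u z| * x z ^ 2 :=
        Finset.sum_sq_le_sum_mul_sum_of_sq_le_mul _ (fun _ _ => abs_nonneg _)
          (fun _ _ => by positivity) fun z _ => by
            rw [mul_pow, ← sq_abs (φ u z), sq |φ u z|, mul_assoc]
    _ ≤ _ := by gcongr; exact hφ u

lemma sq_sum_weighted_mul_mul_le (hw₀ : ∀ z, 0 ≤ w z) (hw₁ : ∀ z, w z ≤ 1)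
    (hφ : ∀ u, ∑ z, |φ u z| ≤ k) (u v : U) :
    (∑ z, w z * φ u z * φ v z) ^ 2 ≤ k ^ 2 * ∑ z, w z * (|φ u z| * |φ v z|) := by
  have hsum : ∑ z, |φ u z| * |φ v z| ≤ k ^ 2 := by
    have hu : 0 ≤ ∑ z, |φ u z| := Finset.sum_nonneg fun _ _ => abs_nonneg _
    calc ∑ z, |φ u z| * |φ v z| ≤ ∑ z, |φ u z| * ∑ z, |φ v z| := by
          gcongr with z
          exact Finset.single_le_sum (f := fun z => |φ v z|) (fun _ _ => abs_nonneg _)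
            (Finset.mem_univ z)
      _ = (∑ z, |φ u z|) * ∑ z, |φ v z| := (Finset.sum_mul ..).symm
      _ ≤ k * k := by gcongr; exacts [hu.trans (hφ u), hφ u, hφ v]
      _ = k ^ 2 := (sq k).symm
  have hterm (z : Z) : 0 ≤ w z * (|φ u z| * |φ v z|) := mul_nonneg (hw₀ z) (by positivity)
  calc _ ≤ (∑ z, |φ u z| * |φ v z|) * ∑ z, w z * (|φ u z| * |φ v z|) :=
        Finset.sum_sq_le_sum_mul_sum_of_sq_le_mul _ (fun _ _ => by positivity)
          (fun z _ => hterm z) fun z _ => by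
            calc (w z * φ u z * φ v z) ^ 2
                = w z * ((|φ u z| * |φ v z|) * (w z * (|φ u z| * |φ v z|))) := by
                  rw [mul_pow, mul_pow, ← sq_abs (φ u z), ← sq_abs (φ v z)]
                  ring
              _ ≤ _ := mul_le_of_le_one_left (mul_nonneg (by positivity) (hterm z)) (hw₁ z)
    _ ≤ _ := by gcongr; exact Finset.sum_nonneg fun z _ => hterm z

variable [Finite U] [MeasurableSpace U] [MeasurableSingletonClass U] {μ : Measure U}
  [IsProbabilityMeasure μ]

lemma integral_sum_weighted_mul (φ : U → Z → ℝ) (x : Z → ℝ) :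
    ∫ v, ∑ z, x z * φ v z ∂μ = ∑ z, x z * ∫ v, φ v z ∂μ := by
  rw [integral_finsetSum _ fun _ _ => .of_finite]
  simp only [integral_const_mul]

lemma integral_crossStat [Nonempty ι] [Nonempty κ] (w : Z → ℝ) (φ : U → Z → ℝ) :
    ∫ s, crossStat w φ s ∂(Measure.pi fun _ : ι => μ).prod (Measure.pi fun _ : κ => μ) =
      ∑ z, w z * (∫ u, φ u z ∂μ) ^ 2 := by
  simp only [crossStat_eq_expect]
  rw [integral_expect_expect (fun u v => ∑ z, w z * φ u z * φ v z)]
  simp only [integral_sum_weighted_mul]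
  rw [integral_finsetSum _ fun _ _ => .of_finite]
  simp only [integral_mul_const, integral_const_mul, sq, mul_assoc]

lemma integral_sq_sum_weighted_le (hw₀ : ∀ z, 0 ≤ w z) (hw₁ : ∀ z, w z ≤ 1)
    (hφ : ∀ u, ∑ z, |φ u z| ≤ k) (hδ : 0 ≤ δ)
    (hA : ∑ z, w z * (k * ∫ u, |φ u z| ∂μ) ^ 2 ≤ δ ^ 2) (x : Z → ℝ) :
    ∫ u, (∑ z, φ u z * (w z * x z)) ^ 2 ∂μ ≤ δ * ∑ z, w z * x z ^ 2 := by
  calc _ ≤ ∫ u, k * ∑ z, |φ u z| * (w z * x z) ^ 2 ∂μ :=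
        integral_mono .of_finite .of_finite fun u => sq_sum_weighted_mul_le hφ _ u
    _ = ∑ z, (w z * (k * ∫ u, |φ u z| ∂μ)) * (w z * x z ^ 2) := by
        rw [integral_const_mul, integral_finsetSum _ fun _ _ => .of_finite, Finset.mul_sum]
        simp only [integral_mul_const]
        exact Finset.sum_congr rfl fun z _ => by ring
    _ ≤ ∑ z, δ * (w z * x z ^ 2) := by
        gcongr with z
        · exact mul_nonneg (hw₀ z) (sq_nonneg _)
        · exact weight_mul_le hw₀ hw₁ hδ hA z
    _ = _ := by rw [← Finset.mul_sum]

lemma integral_integral_sq_sum_weighted_le (hw₀ : ∀ z, 0 ≤ w z) (hw₁ : ∀ z, w z ≤ 1)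
    (hφ : ∀ u, ∑ z, |φ u z| ≤ k) :
    ∫ u, ∫ v, (∑ z, w z * φ u z * φ v z) ^ 2 ∂μ ∂μ ≤
      ∑ z, w z * (k * ∫ u, |φ u z| ∂μ) ^ 2 := by
  calc _ ≤ ∫ u, ∫ v, k ^ 2 * ∑ z, w z * (|φ u z| * |φ v z|) ∂μ ∂μ :=
        integral_mono .of_finite .of_finite fun u => integral_mono .of_finite .of_finite fun v =>
          sq_sum_weighted_mul_mul_le hw₀ hw₁ hφ u v
    _ = _ := by
        simp only [integral_const_mul, integral_finsetSum, Integrable.of_finite, implies_true,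
          integral_mul_const]
        rw [Finset.mul_sum]
        exact Finset.sum_congr rfl fun z _ => by ring

lemma variance_crossStat_le [Nonempty ι] (hw₀ : ∀ z, 0 ≤ w z) (hw₁ : ∀ z, w z ≤ 1)
    (hφ : ∀ u, ∑ z, |φ u z| ≤ k) (hδ : 0 ≤ δ)
    (hA : ∑ z, w z * (k * ∫ u, |φ u z| ∂μ) ^ 2 ≤ δ ^ 2) :
    Var[crossStat w φ; (Measure.pi fun _ : ι => μ).prod (Measure.pi fun _ : ι => μ)] ≤
      2 * (δ * ∑ z, w z * (∫ u, φ u z ∂μ) ^ 2) / Fintype.card ι +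
        δ ^ 2 / Fintype.card ι ^ 2 := by
  have hleft (u : U) : ∫ v, ∑ z, w z * φ u z * φ v z ∂μ =
      ∑ z, φ u z * (w z * ∫ v, φ v z ∂μ) := by
    rw [integral_sum_weighted_mul]
    exact Finset.sum_congr rfl fun z _ => by ring
  have hright (v : U) : ∫ u, ∑ z, w z * φ u z * φ v z ∂μ =
      ∑ z, φ v z * (w z * ∫ u, φ u z ∂μ) := by
    simp only [mul_right_comm (w _) _ (φ v _), integral_sum_weighted_mul]
    exact Finset.sum_congr rfl fun z _ => by ring
  have hvar := variance_expect_expect_le (ι := ι) (κ := ι) (μ := μ) (ν := μ)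
    fun u v => ∑ z, w z * φ u z * φ v z
  simp only [hleft, hright, ← crossStat_eq_expect] at hvar
  refine hvar.trans ?_
  rw [mul_div_assoc, two_mul, sq (Fintype.card ι : ℝ)]
  gcongr
  · exact integral_sq_sum_weighted_le hw₀ hw₁ hφ hδ hA _
  · exact integral_sq_sum_weighted_le hw₀ hw₁ hφ hδ hA _
  · exact (integral_integral_sq_sum_weighted_le hw₀ hw₁ hφ).trans hA

lemma measureReal_abs_sub_integral_ge_le {Ω : Type*} [MeasurableSpace Ω] {P : Measure Ω}
    [IsFiniteMeasure P] {X : Ω → ℝ} (hX : MemLp X 2 P) {c : ℝ} (hc : 0 < c) :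
    P.real {ω | c ≤ |X ω - ∫ ω', X ω' ∂P|} ≤ Var[X; P] / c ^ 2 :=
  ENNReal.toReal_le_of_le_ofReal (div_nonneg (variance_nonneg X P) (sq_nonneg c))
    (meas_ge_le_variance_div_sq hX hc)

lemma measureReal_abs_crossStat_sub_ge_le [Nonempty ι] (hw₀ : ∀ z, 0 ≤ w z) (hw₁ : ∀ z, w z ≤ 1)
    (hφ : ∀ u, ∑ z, |φ u z| ≤ k) {c : ℝ} (hc : 0 < c)
    (hA : ∑ z, w z * (k * ∫ u, |φ u z| ∂μ) ^ 2 ≤ (Fintype.card ι * c / 1000) ^ 2)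
    (hS : ∑ z, w z * (∫ u, φ u z ∂μ) ^ 2 ≤ 2 * c) :
    ((Measure.pi fun _ : ι => μ).prod (Measure.pi fun _ : ι => μ)).real
      {s | c ≤ |crossStat w φ s - ∑ z, w z * (∫ u, φ u z ∂μ) ^ 2|} ≤ 1 / 200 := by
  have hm : (0 : ℝ) < Fintype.card ι := by exact_mod_cast Fintype.card_pos
  have hvar := variance_crossStat_le (ι := ι) hw₀ hw₁ hφ (by positivity) hA
  rw [← integral_crossStat (ι := ι) (κ := ι)] at hS hvar ⊢
  refine (measureReal_abs_sub_integral_ge_le .of_discrete hc).trans ?_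
  rw [div_le_iff₀ (by positivity)]
  calc _ ≤ _ := hvar
    _ ≤ 2 * (Fintype.card ι * c / 1000 * (2 * c)) / Fintype.card ι +
        (Fintype.card ι * c / 1000) ^ 2 / Fintype.card ι ^ 2 := by gcongr
    _ = (4 / 1000 + 1 / 1000 ^ 2) * c ^ 2 := by field_simp; ring
    _ ≤ 1 / 200 * c ^ 2 := by gcongr; norm_num

lemma measureReal_crossStat_lt_le [Nonempty ι] (hw₀ : ∀ z, 0 ≤ w z) (hw₁ : ∀ z, w z ≤ 1)
    (hφ : ∀ u, ∑ z, |φ u z| ≤ k) {S : ℝ} (hS : ∑ z, w z * (∫ u, φ u z ∂μ) ^ 2 = S) (hS₀ : 0 < S)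
    (hA : ∑ z, w z * (k * ∫ u, |φ u z| ∂μ) ^ 2 ≤ (Fintype.card ι * S / 2000) ^ 2) {τ : ℝ}
    (hτ : 2 * τ ≤ S) :
    ((Measure.pi fun _ : ι => μ).prod (Measure.pi fun _ : ι => μ)).real
      {s | crossStat w φ s < τ} ≤ 1 / 200 := by
  refine (measureReal_mono fun s (hs : _ < τ) => ?_).trans
    (measureReal_abs_crossStat_sub_ge_le hw₀ hw₁ hφ (c := S / 2) (half_pos hS₀)
      (hA.trans_eq (by ring)) (by linarith))
  rw [Set.mem_ofPred_eq, hS]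
  exact (show S / 2 ≤ S - crossStat w φ s by linarith).trans (sub_le_iff_le_add.2 (by
    linarith [neg_abs_le (crossStat w φ s - S)]))

end CrossStat

section PointMass

variable {Z : Type*}

/-- The mass function of the point mass at `x`: the feature vector whose means are empirical
frequencies. -/
noncomputable def pointMass (x : Z) : Z → ℝ := Set.indicator {x} 1

lemma pointMass_nonneg (x z : Z) : 0 ≤ pointMass x z :=
  Set.indicator_nonneg (fun _ _ => zero_le_one) z

lemma pointMass_mul_inv_eq (x z : Z) (c : ℝ) :
    pointMass x z * (pointMass x z + c)⁻¹ = pointMass x z * (1 + c)⁻¹ := by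
  classical by_cases h : z = x <;> simp [pointMass, h]

lemma sum_pointMass [Fintype Z] (x : Z) : ∑ z, pointMass x z = 1 := by
  classical simp [pointMass, Set.indicator_apply]

lemma integral_pointMass_comp {U : Type*} [MeasurableSpace U] [MeasurableSpace Z]
    [MeasurableSingletonClass Z] {μ : Measure U} {f : U → Z} (hf : Measurable f) (z : Z) :
    ∫ u, pointMass (f u) z ∂μ = (μ.map f).real {z} := by
  have hindicator (u : U) : pointMass (f u) z = (f ⁻¹' {z}).indicator 1 u := by
    classical simp [pointMass, Set.indicator_apply, eq_comm]
  simp only [hindicator]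
  rw [integral_indicator_one (hf (measurableSet_singleton z)),
    map_measureReal_apply hf (measurableSet_singleton z)]

end PointMass

section NormStat

variable {U Z ι : Type*} [Fintype ι] [Fintype Z] {w : Z → ℝ}

/-- The `w`-weighted inner product of the empirical laws of `f` over two samples. -/
noncomputable def normStat (w : Z → ℝ) (f : U → Z) (s : (ι → U) × (ι → U)) : ℝ :=
  crossStat w (fun u => pointMass (f u)) s

lemma normStat_nonneg (hw₀ : ∀ z, 0 ≤ w z) (f : U → Z) (s : (ι → U) × (ι → U)) :
    0 ≤ normStat w f s :=
  Finset.sum_nonneg fun z _ => mul_nonneg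
    (mul_nonneg (hw₀ z) (Finset.expect_nonneg fun _ _ => pointMass_nonneg _ _))
    (Finset.expect_nonneg fun _ _ => pointMass_nonneg _ _)

variable [Nonempty ι] [Finite U] [MeasurableSpace U] [MeasurableSingletonClass U]
  [MeasurableSpace Z] [MeasurableSingletonClass Z] {μ : Measure U} [IsProbabilityMeasure μ]

lemma integral_normStat (w : Z → ℝ) (f : U → Z) :
    ∫ s, normStat w f s ∂(Measure.pi fun _ : ι => μ).prod (Measure.pi fun _ : ι => μ) =
      ∑ z, w z * (μ.map f).real {z} ^ 2 := by
  simp only [normStat, integral_crossStat, integral_pointMass_comp (measurable_of_finite f)]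

lemma measureReal_normStat_lt_le (hw₀ : ∀ z, 0 ≤ w z) (hw₁ : ∀ z, w z ≤ 1) (f : U → Z) {q : ℝ}
    (hq : 0 < q) (hnorm : 2 * q ≤ ∑ z, w z * (μ.map f).real {z} ^ 2)
    (hmq : 1 ≤ (Fintype.card ι / 10000) ^ 2 * q) :
    ((Measure.pi fun _ : ι => μ).prod (Measure.pi fun _ : ι => μ)).real
      {s | normStat w f s < q} ≤ 1 / 200 := by
  have hf : Measurable f := measurable_of_finite f
  have habs (u : U) (z : Z) : |pointMass (f u) z| = pointMass (f u) z :=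
    abs_of_nonneg (pointMass_nonneg _ _)
  set S := ∑ z, w z * (μ.map f).real {z} ^ 2
  refine measureReal_crossStat_lt_le hw₀ hw₁ (k := 1) (S := S) ?_ ?_ (by linarith) ?_ hnorm
  · simp only [habs, sum_pointMass, le_refl, implies_true]
  · simp only [integral_pointMass_comp hf, S]
  · simp only [habs, integral_pointMass_comp hf, one_mul]
    calc S = 1 * S := (one_mul S).symm
      _ ≤ (Fintype.card ι / 10000) ^ 2 * S * S := by
          gcongr
          · linarith
          · exact hmq.trans (by gcongr; linarith)
      _ ≤ (Fintype.card ι * S / 2000) ^ 2 := by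
          linarith [sq_nonneg (Fintype.card ι * S)]

end NormStat

section Closeness

variable {T ι : Type*} [Fintype ι] [Nonempty ι]

lemma abs_pointMass_sub_le (u : T × T) (z : T) :
    |(pointMass u.1 - pointMass u.2) z| ≤ pointMass u.1 z + pointMass u.2 z :=
  (abs_sub _ _).trans_eq (by
    rw [abs_of_nonneg (pointMass_nonneg _ _),
      abs_of_nonneg (pointMass_nonneg _ _)])

lemma integral_pointMass_sub [Finite T] [MeasurableSpace T] [MeasurableSingletonClass T]
    {P Q : Measure T} [IsProbabilityMeasure P] [IsProbabilityMeasure Q] (z : T) :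
    ∫ u, (pointMass u.1 - pointMass u.2) z ∂P.prod Q = P.real {z} - Q.real {z} := by
  simp only [Pi.sub_apply]
  rw [integral_sub .of_finite .of_finite, integral_pointMass_comp measurable_fst,
    integral_pointMass_comp measurable_snd]
  simp

lemma integral_abs_pointMass_sub_le [Finite T] [MeasurableSpace T] [MeasurableSingletonClass T]
    {P Q : Measure T} [IsProbabilityMeasure P] [IsProbabilityMeasure Q] (z : T) :
    ∫ u, |(pointMass u.1 - pointMass u.2) z| ∂P.prod Q ≤ P.real {z} + Q.real {z} := by
  refine (integral_mono .of_finite .of_finite fun u => abs_pointMass_sub_le u z).trans_eq ?_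
  rw [integral_add .of_finite .of_finite, integral_pointMass_comp measurable_fst,
    integral_pointMass_comp measurable_snd]
  simp

variable [Fintype T]

/-- The `w`-weighted squared distance between the empirical laws of the two components of a sample
of pairs, estimated from two samples so as to be unbiased. -/
noncomputable def distStat (w : T → ℝ) (s : (ι → T × T) × (ι → T × T)) : ℝ :=
  crossStat w (fun u => pointMass u.1 - pointMass u.2) s

lemma sum_abs_pointMass_sub_le (u : T × T) :
    ∑ z, |(pointMass u.1 - pointMass u.2) z| ≤ 2 :=
  (Finset.sum_le_sum fun z _ => abs_pointMass_sub_le u z).trans_eq (by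
    rw [Finset.sum_add_distrib, sum_pointMass, sum_pointMass, one_add_one_eq_two])

variable [MeasurableSpace T] [MeasurableSingletonClass T] {P Q : Measure T}
  [IsProbabilityMeasure P] [IsProbabilityMeasure Q] {w : T → ℝ} {τ : ℝ}

lemma sum_weight_mul_sq_integral_abs_le (hw₀ : ∀ z, 0 ≤ w z) :
    ∑ z, w z * (2 * ∫ u, |(pointMass u.1 - pointMass u.2) z| ∂P.prod Q) ^ 2 ≤
      32 * ∑ z, w z * Q.real {z} ^ 2 + 8 * ∑ z, w z * (P.real {z} - Q.real {z}) ^ 2 := by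
  rw [Finset.mul_sum, Finset.mul_sum, ← Finset.sum_add_distrib]
  refine Finset.sum_le_sum fun z _ => ?_
  calc _ ≤ w z * (2 * (P.real {z} + Q.real {z})) ^ 2 := by
        gcongr
        · exact hw₀ z
        · exact integral_abs_pointMass_sub_le z
    _ ≤ w z * (32 * Q.real {z} ^ 2 + 8 * (P.real {z} - Q.real {z}) ^ 2) := by
        gcongr
        · exact hw₀ z
        · nlinarith [sq_nonneg (P.real {z} - 3 * Q.real {z})]
    _ = _ := by ring

lemma measureReal_le_distStat_le (hw₀ : ∀ z, 0 ≤ w z) (hw₁ : ∀ z, w z ≤ 1) (hτ : 0 < τ)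
    (hQ : ∑ z, w z * Q.real {z} ^ 2 ≤ (Fintype.card ι * τ / 10000) ^ 2) :
    ((Measure.pi fun _ : ι => Q.prod Q).prod (Measure.pi fun _ : ι => Q.prod Q)).real
      {s | τ ≤ distStat w s} ≤ 1 / 200 := by
  have hzero : ∑ z, w z * (∫ u, (pointMass u.1 - pointMass u.2) z ∂Q.prod Q) ^ 2 = 0 := by
    simp only [integral_pointMass_sub, sub_self, ne_eq, two_ne_zero, not_false_eq_true, zero_pow,
      mul_zero, Finset.sum_const_zero]
  have hconc := measureReal_abs_crossStat_sub_ge_le (ι := ι) (μ := Q.prod Q) hw₀ hw₁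
    sum_abs_pointMass_sub_le hτ
    (by
      refine (sum_weight_mul_sq_integral_abs_le hw₀).trans ?_
      simp only [sub_self, ne_eq, two_ne_zero, not_false_eq_true, zero_pow, mul_zero,
        Finset.sum_const_zero]
      linarith [sq_nonneg (Fintype.card ι * τ)])
    (by rw [hzero]; positivity)
  simp only [hzero, sub_zero] at hconc
  exact (measureReal_mono fun s (hs : τ ≤ _) => hs.trans (le_abs_self _)).trans hconc

lemma measureReal_distStat_lt_le (hw₀ : ∀ z, 0 ≤ w z) (hw₁ : ∀ z, w z ≤ 1) (hτ : 0 < τ)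
    (hQ : ∑ z, w z * Q.real {z} ^ 2 ≤ (Fintype.card ι * τ / 10000) ^ 2)
    (hfar : 2 * τ ≤ ∑ z, w z * (P.real {z} - Q.real {z}) ^ 2)
    (hmfar : 1 ≤ (Fintype.card ι / 10000) ^ 2 * ∑ z, w z * (P.real {z} - Q.real {z}) ^ 2) :
    ((Measure.pi fun _ : ι => P.prod Q).prod (Measure.pi fun _ : ι => P.prod Q)).real
      {s | distStat w s < τ} ≤ 1 / 200 := by
  set S := ∑ z, w z * (P.real {z} - Q.real {z}) ^ 2
  have hS : 0 < S := by linarith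
  refine measureReal_crossStat_lt_le hw₀ hw₁ sum_abs_pointMass_sub_le (S := S)
    (by simp only [integral_pointMass_sub, S]) hS ?_ hfar
  have hSle : S ≤ (Fintype.card ι * S / 10000) ^ 2 := by
    calc S = 1 * S := (one_mul S).symm
      _ ≤ (Fintype.card ι / 10000) ^ 2 * S * S := by gcongr
      _ = _ := by ring
  have hQle : ∑ z, w z * Q.real {z} ^ 2 ≤ (Fintype.card ι * (S / 2) / 10000) ^ 2 :=
    hQ.trans (by gcongr; linarith)
  refine (sum_weight_mul_sq_integral_abs_le hw₀).trans ?_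
  linarith [sq_nonneg (Fintype.card ι * S)]

end Closeness

section Singletons

lemma map_measureReal_singleton_eq_sum {X Y : Type*} [Fintype X] [MeasurableSpace X]
    [MeasurableSingletonClass X] [MeasurableSpace Y] [MeasurableSingletonClass Y] (μ : Measure X)
    [IsFiniteMeasure μ] (f : X → Y) (y : Y) :
    (μ.map f).real {y} = ∑ x, μ.real {x} * pointMass (f x) y := by
  rw [← integral_pointMass_comp (measurable_of_finite f), integral_fintype .of_finite]
  rfl

lemma prod_measureReal_singleton {X Y : Type*} [MeasurableSpace X] [MeasurableSpace Y]
    (μ : Measure X) (ν : Measure Y) [SFinite ν] (z : X × Y) :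
    (μ.prod ν).real {z} = μ.real {z.1} * ν.real {z.2} := by
  rw [← measureReal_prod_prod, Set.singleton_prod_singleton]

end Singletons

section TotalVariation

variable {X Y : Type*} [Fintype X] [Fintype Y] [MeasurableSpace X] [MeasurableSpace Y]

/-- Total variation distance between two probability measures on a finite type. -/
noncomputable def tv (μ ν : Measure X) : ℝ := 1 / 2 * ∑ x, |μ.real {x} - ν.real {x}|

lemma tv_self (μ : Measure X) : tv μ μ = 0 := by
  simp only [tv, sub_self, abs_zero, Finset.sum_const_zero, mul_zero]

lemma tv_comm (μ ν : Measure X) : tv μ ν = tv ν μ := by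
  simp only [tv, abs_sub_comm]

lemma tv_triangle (μ ν ρ : Measure X) : tv μ ρ ≤ tv μ ν + tv ν ρ := by
  rw [tv, tv, tv, ← mul_add, ← Finset.sum_add_distrib]
  gcongr
  exact abs_sub_le _ _ _

lemma sq_tv_le (μ ν : Measure X) :
    tv μ ν ^ 2 ≤ Fintype.card X / 4 * ∑ x, (μ.real {x} - ν.real {x}) ^ 2 := by
  have hcs := sq_sum_le_card_mul_sum_sq (s := Finset.univ)
    (f := fun x => |μ.real {x} - ν.real {x}|)
  simp only [sq_abs, Finset.card_univ] at hcs
  rw [tv, mul_pow]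
  linarith

variable [MeasurableSingletonClass X] [MeasurableSingletonClass Y]

lemma tvDist_eq_tv (p q : PMF X) : tvDist p q = tv p.toMeasure q.toMeasure := by
  simp only [tvDist, tv, measureReal_def,
    PMF.toMeasure_apply_singleton _ _ (measurableSet_singleton _)]

lemma sum_measureReal_singleton_univ (μ : Measure X) [IsProbabilityMeasure μ] :
    ∑ x, μ.real {x} = 1 := by
  rw [sum_measureReal_singleton, Finset.coe_univ, probReal_univ]

lemma tv_eq_sum_max (μ ν : Measure X) [IsProbabilityMeasure μ] [IsProbabilityMeasure ν] :
    tv μ ν = ∑ x, max (μ.real {x} - ν.real {x}) 0 := by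
  have hsum : ∑ x, (μ.real {x} - ν.real {x}) = 0 := by
    rw [Finset.sum_sub_distrib, sum_measureReal_singleton_univ, sum_measureReal_singleton_univ,
      sub_self]
  have hmax (x : X) : max (μ.real {x} - ν.real {x}) 0 =
      1 / 2 * |μ.real {x} - ν.real {x}| + 1 / 2 * (μ.real {x} - ν.real {x}) := by
    obtain h | h := le_total (μ.real {x} - ν.real {x}) 0
    · rw [max_eq_right h, abs_of_nonpos h]
      ring
    · rw [max_eq_left h, abs_of_nonneg h]
      ring
  simp only [hmax, Finset.sum_add_distrib, ← Finset.mul_sum, hsum, mul_zero, add_zero, tv]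

lemma tv_le_one (μ ν : Measure X) [IsProbabilityMeasure μ] [IsProbabilityMeasure ν] :
    tv μ ν ≤ 1 := by
  rw [tv_eq_sum_max, ← sum_measureReal_singleton_univ μ]
  gcongr with x
  exact max_le (sub_le_self _ measureReal_nonneg) measureReal_nonneg

lemma tv_map_le (μ ν : Measure X) [IsFiniteMeasure μ] [IsFiniteMeasure ν] (f : X → Y) :
    tv (μ.map f) (ν.map f) ≤ tv μ ν := by
  have hpoint (y : Y) : |(μ.map f).real {y} - (ν.map f).real {y}| ≤
      ∑ x, |μ.real {x} - ν.real {x}| * pointMass (f x) y := by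
    simp only [map_measureReal_singleton_eq_sum, ← Finset.sum_sub_distrib, ← sub_mul]
    refine (Finset.abs_sum_le_sum_abs _ _).trans_eq (Finset.sum_congr rfl fun x _ => ?_)
    rw [abs_mul, abs_of_nonneg (pointMass_nonneg _ _)]
  refine mul_le_mul_of_nonneg_left ((Finset.sum_le_sum fun y _ => hpoint y).trans_eq ?_)
    (by norm_num)
  rw [Finset.sum_comm]
  simp only [← Finset.mul_sum, sum_pointMass, mul_one]

lemma tv_prod_le (μ μ' : Measure X) (ν ν' : Measure Y) [IsProbabilityMeasure μ]
    [IsProbabilityMeasure ν] [IsProbabilityMeasure μ'] [IsProbabilityMeasure ν'] :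
    tv (μ.prod ν) (μ'.prod ν') ≤ tv μ μ' + tv ν ν' := by
  have hpoint (x : X) (y : Y) : |μ.real {x} * ν.real {y} - μ'.real {x} * ν'.real {y}| ≤
      |μ.real {x} - μ'.real {x}| * ν.real {y} + μ'.real {x} * |ν.real {y} - ν'.real {y}| := by
    calc _ = |(μ.real {x} - μ'.real {x}) * ν.real {y} +
          μ'.real {x} * (ν.real {y} - ν'.real {y})| := by ring_nf
      _ ≤ _ := (abs_add_le _ _).trans_eq (by
        rw [abs_mul, abs_mul, abs_of_nonneg (measureReal_nonneg (μ := ν)),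
          abs_of_nonneg (measureReal_nonneg (μ := μ'))])
  simp only [tv, prod_measureReal_singleton, ← mul_add]
  gcongr
  rw [Fintype.sum_prod_type]
  refine (Finset.sum_le_sum fun x _ => Finset.sum_le_sum fun y _ => hpoint x y).trans_eq ?_
  simp only [Finset.sum_add_distrib, ← Finset.mul_sum, ← Finset.sum_mul,
    sum_measureReal_singleton_univ, mul_one, one_mul]

end TotalVariation

section Empirical

variable {Y : Type*} [MeasurableSpace Y] {m : ℕ}

/-- The empirical distribution of a sample. -/
noncomputable def empirical (s : Fin m → Y) : Measure Y := (uniformOn Set.univ).map s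

instance [NeZero m] (s : Fin m → Y) : IsProbabilityMeasure (empirical s) :=
  Measure.isProbabilityMeasure_map (measurable_of_finite s).aemeasurable

variable [MeasurableSingletonClass Y]

lemma empirical_real_singleton (s : Fin m → Y) (y : Y) :
    (empirical s).real {y} = 𝔼 i, pointMass (s i) y := by
  rw [empirical, map_measureReal_singleton_eq_sum]
  simp [measureReal_def, uniformOn_univ, Fintype.expect_eq_sum_div_card, ← Finset.mul_sum,
    div_eq_inv_mul]

lemma integral_sq_empirical_sub_le [Finite Y] [NeZero m] (P : Measure Y) [IsProbabilityMeasure P]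
    (y : Y) :
    ∫ s, ((empirical s).real {y} - P.real {y}) ^ 2 ∂Measure.pi (fun _ : Fin m => P) ≤
      P.real {y} / m := by
  have hmean : ∫ u, pointMass u y ∂P = P.real {y} := by
    simpa using integral_pointMass_comp measurable_id y
  have hsq (u : Y) : pointMass u y ^ 2 = pointMass u y := by
    classical by_cases h : y = u <;> simp [pointMass, h]
  have hvar : Var[fun u => pointMass u y; P] ≤ P.real {y} := by
    refine (variance_le_expectation_sq AEStronglyMeasurable.of_discrete).trans_eq ?_
    simp only [Pi.pow_apply, hsq, hmean]
  calc _ = Var[fun s => 𝔼 i, pointMass (s i) y; Measure.pi fun _ : Fin m => P] := by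
        rw [variance_eq_integral (Measurable.of_discrete).aemeasurable,
          integral_expect_pi (g := fun u => pointMass u y) .of_finite, hmean]
        simp only [empirical_real_singleton]
    _ = Var[fun u => pointMass u y; P] / m := by
        rw [variance_expect_pi (g := fun u => pointMass u y) .of_discrete, Fintype.card_fin]
    _ ≤ _ := by gcongr

variable [Fintype Y] [NeZero m] (P : Measure Y) [IsProbabilityMeasure P]

lemma integral_sq_tv_empirical_le :
    ∫ s, tv (empirical s) P ^ 2 ∂Measure.pi (fun _ : Fin m => P) ≤ Fintype.card Y / (4 * m) := by
  calc _ ≤ ∫ s, Fintype.card Y / 4 * ∑ y, ((empirical s).real {y} - P.real {y}) ^ 2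
            ∂Measure.pi (fun _ : Fin m => P) :=
        integral_mono .of_finite .of_finite fun s => sq_tv_le _ _
    _ ≤ Fintype.card Y / 4 * ∑ y, P.real {y} / m := by
        rw [integral_const_mul, integral_finsetSum _ fun _ _ => .of_finite]
        gcongr
        exact integral_sq_empirical_sub_le P _
    _ = _ := by
        rw [← Finset.sum_div, sum_measureReal_singleton_univ]
        ring

lemma measureReal_le_tv_empirical_le {c η : ℝ} (hc : 0 < c)
    (hm : Fintype.card Y ≤ 4 * η * m * c ^ 2) :
    (Measure.pi fun _ : Fin m => P).real {s | c ≤ tv (empirical s) P} ≤ η := by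
  have hm₀ : (0 : ℝ) < m := by exact_mod_cast NeZero.pos m
  have hmarkov := mul_meas_ge_le_integral_of_nonneg (μ := Measure.pi fun _ : Fin m => P)
    (f := fun s => tv (empirical s) P ^ 2) (.of_forall fun s => sq_nonneg _) .of_finite (c ^ 2)
  have hsub : {s : Fin m → Y | c ≤ tv (empirical s) P} ⊆ {s | c ^ 2 ≤ tv (empirical s) P ^ 2} :=
    fun s hs => pow_le_pow_left₀ hc.le hs 2
  refine (measureReal_mono hsub).trans (le_of_mul_le_mul_left (hmarkov.trans ?_) (pow_pos hc 2))
  refine (integral_sq_tv_empirical_le P).trans ?_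
  rw [div_le_iff₀ (by positivity)]
  linarith

end Empirical

section Flattening

variable {Y : Type*} [MeasurableSpace Y] {m : ℕ}

lemma integral_pointMass_mul_inv_sum [Finite Y] [MeasurableSingletonClass Y] (P : Measure Y)
    [IsProbabilityMeasure P] (y : Y) (j : Fin (m + 1)) :
    ∫ t, pointMass (t j) y * (∑ i, pointMass (t i) y)⁻¹ ∂Measure.pi (fun _ => P) =
      P.real {y} * ∫ s : Fin m → Y, (1 + ∑ i, pointMass (s i) y)⁻¹ ∂Measure.pi (fun _ => P) := by
  have hsplit := (measurePreserving_piFinSuccAbove (fun _ => P) j).integral_comp'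
    fun q : Y × (Fin m → Y) => pointMass q.1 y * (1 + ∑ i, pointMass (q.2 i) y)⁻¹
  rw [integral_prod_mul (fun u => pointMass u y) fun s : Fin m → Y =>
    (1 + ∑ i, pointMass (s i) y)⁻¹] at hsplit
  rw [show P.real {y} = ∫ u, pointMass u y ∂P by
    simpa using (integral_pointMass_comp measurable_id y).symm, ← hsplit]
  refine integral_congr_ae (.of_forall fun t => ?_)
  simp only [Fin.sum_univ_succAbove _ j, pointMass_mul_inv_eq]
  rfl

-- Among `m + 1` exchangeable draws, each one is a uniformly random one of the occurrences of `y`.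
lemma measureReal_mul_integral_inv_count_le [Finite Y] [MeasurableSingletonClass Y] (P : Measure Y)
    [IsProbabilityMeasure P] (m : ℕ) (y : Y) :
    P.real {y} * ∫ s : Fin m → Y, (1 + ∑ i, pointMass (s i) y)⁻¹ ∂Measure.pi (fun _ => P) ≤
      ((m : ℝ) + 1)⁻¹ := by
  have hsum : ∑ j : Fin (m + 1), ∫ t, pointMass (t j) y * (∑ i, pointMass (t i) y)⁻¹
      ∂Measure.pi (fun _ => P) ≤ 1 := by
    rw [← integral_finsetSum _ fun _ _ => .of_finite]
    calc _ ≤ ∫ _, (1 : ℝ) ∂Measure.pi (fun _ : Fin (m + 1) => P) :=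
          integral_mono .of_finite .of_finite fun t => by
            rw [← Finset.sum_mul]
            exact mul_inv_le_one
      _ = 1 := by simp
  simp only [integral_pointMass_mul_inv_sum, Finset.sum_const, Finset.card_univ, Fintype.card_fin,
    nsmul_eq_mul, Nat.cast_add, Nat.cast_one] at hsum
  rwa [← one_div, le_div_iff₀' (by positivity)]

variable [Fintype Y]

/-- The number of buckets, not necessarily integral, into which flattening splits the point `y`:
its share grows with its mass under the prediction `r` and under the sample `s`. -/
noncomputable def buckets (r : Measure Y) (s : Fin m → Y) (y : Y) : ℝ :=
  1 + Fintype.card Y * (r.real {y} + (empirical s).real {y})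

/-- The squared `ℓ²` norm of `P` once the mass of each point is spread evenly over its buckets. -/
noncomputable def flatNorm (P r : Measure Y) (s : Fin m → Y) : ℝ :=
  ∑ y, (buckets r s y)⁻¹ * P.real {y} ^ 2

lemma one_le_buckets (r : Measure Y) (s : Fin m → Y) (y : Y) : 1 ≤ buckets r s y := by
  rw [buckets, le_add_iff_nonneg_right]
  positivity

lemma buckets_pos (r : Measure Y) (s : Fin m → Y) (y : Y) : 0 < buckets r s y :=
  zero_lt_one.trans_le (one_le_buckets r s y)

lemma flatNorm_nonneg (P r : Measure Y) (s : Fin m → Y) : 0 ≤ flatNorm P r s :=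
  Finset.sum_nonneg fun y _ => mul_nonneg (inv_nonneg.2 (buckets_pos r s y).le) (sq_nonneg _)

lemma measureReal_mul_inv_buckets_le [Nonempty Y] (r : Measure Y) (s : Fin m → Y) (y : Y) :
    r.real {y} * (buckets r s y)⁻¹ ≤ (Fintype.card Y : ℝ)⁻¹ := by
  have hcard : (0 : ℝ) < Fintype.card Y := by exact_mod_cast Fintype.card_pos
  rw [← div_eq_mul_inv, div_le_iff₀ (buckets_pos r s y), ← div_eq_inv_mul, le_div_iff₀ hcard,
    buckets]
  nlinarith [measureReal_nonneg (μ := empirical s) (s := {y})]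

variable [MeasurableSingletonClass Y]

lemma sum_buckets [NeZero m] (r : Measure Y) [IsProbabilityMeasure r] (s : Fin m → Y) :
    ∑ y, buckets r s y = 3 * Fintype.card Y := by
  simp only [buckets, Finset.sum_add_distrib, ← Finset.mul_sum, sum_measureReal_singleton_univ,
    Finset.sum_const, Finset.card_univ, nsmul_eq_mul]
  ring

lemma inv_buckets_le [Nonempty Y] [NeZero m] (r : Measure Y) (s : Fin m → Y) (y : Y) :
    (buckets r s y)⁻¹ ≤ (1 + (m : ℝ) / Fintype.card Y) * (1 + ∑ i, pointMass (s i) y)⁻¹ := by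
  have hcard : (0 : ℝ) < Fintype.card Y := by exact_mod_cast Fintype.card_pos
  have hm : (0 : ℝ) < m := by exact_mod_cast NeZero.pos m
  have hcount : 0 ≤ ∑ i, pointMass (s i) y := Finset.sum_nonneg fun i _ => pointMass_nonneg _ _
  have : 0 ≤ r.real {y} := measureReal_nonneg
  rw [← div_eq_mul_inv, inv_le_comm₀ (buckets_pos r s y) (by positivity), inv_div,
    div_le_iff₀ (by positivity), buckets, empirical_real_singleton, Fintype.expect_eq_sum_div_card,
    Fintype.card_fin]
  set c : ℝ := (Fintype.card Y : ℝ)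
  set n := ∑ i, pointMass (s i) y
  calc 1 + n ≤ 1 + n + (m / c + c * r.real {y} * (1 + m / c) + c * (n / m)) := by
        rw [le_add_iff_nonneg_right]
        positivity
    _ = (1 + c * (r.real {y} + n / m)) * (1 + m / c) := by field_simp; ring

lemma inv_buckets_mul_sq_le [Nonempty Y] [NeZero m] (P r : Measure Y) (s : Fin m → Y) (y : Y) :
    (buckets r s y)⁻¹ * P.real {y} ^ 2 ≤
      P.real {y} * (Fintype.card Y : ℝ)⁻¹ +
        max (P.real {y} - r.real {y}) 0 * (1 + (m : ℝ) / Fintype.card Y) *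
          (P.real {y} * (1 + ∑ i, pointMass (s i) y)⁻¹) := by
  set b := buckets r s y
  set e := max (P.real {y} - r.real {y}) 0
  have hb : 0 < b := buckets_pos r s y
  have hexcess : P.real {y} ≤ r.real {y} + e := sub_le_iff_le_add'.1 (le_max_left _ _)
  have : 0 ≤ e := le_max_right _ _
  calc b⁻¹ * P.real {y} ^ 2 = P.real {y} * b⁻¹ * P.real {y} := by ring
    _ ≤ P.real {y} * b⁻¹ * (r.real {y} + e) := by gcongr
    _ = P.real {y} * (r.real {y} * b⁻¹) + e * (P.real {y} * b⁻¹) := by ring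
    _ ≤ P.real {y} * (Fintype.card Y : ℝ)⁻¹ + e * (P.real {y} *
          ((1 + (m : ℝ) / Fintype.card Y) * (1 + ∑ i, pointMass (s i) y)⁻¹)) := by
        gcongr
        · exact measureReal_mul_inv_buckets_le r s y
        · exact inv_buckets_le r s y
    _ = _ := by ring

lemma integral_flatNorm_le [NeZero m] (P r : Measure Y) [IsProbabilityMeasure P]
    [IsProbabilityMeasure r] :
    ∫ s : Fin m → Y, flatNorm P r s ∂Measure.pi (fun _ => P) ≤
      (Fintype.card Y : ℝ)⁻¹ + tv P r * ((m : ℝ)⁻¹ + (Fintype.card Y : ℝ)⁻¹) := by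
  have : Nonempty Y := P.nonempty_of_neZero
  have hm : (0 : ℝ) < m := by exact_mod_cast NeZero.pos m
  have : (0 : ℝ) < Fintype.card Y := by exact_mod_cast Fintype.card_pos
  have hpoint (y : Y) :
      ∫ s : Fin m → Y, (buckets r s y)⁻¹ * P.real {y} ^ 2 ∂Measure.pi (fun _ => P) ≤
      P.real {y} * (Fintype.card Y : ℝ)⁻¹ +
        max (P.real {y} - r.real {y}) 0 * ((m : ℝ)⁻¹ + (Fintype.card Y : ℝ)⁻¹) := by
    refine (integral_mono .of_finite .of_finite fun s => inv_buckets_mul_sq_le P r s y).trans ?_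
    rw [integral_add .of_finite .of_finite, integral_const_mul, integral_const_mul, integral_const,
      probReal_univ, one_smul, mul_assoc (max _ _)]
    gcongr
    calc _ ≤ (1 + (m : ℝ) / Fintype.card Y) * (m : ℝ)⁻¹ := by
          gcongr
          rw [integral_const_mul]
          refine (measureReal_mul_integral_inv_count_le P m y).trans ?_
          gcongr
          linarith
      _ = _ := by field_simp
  simp only [flatNorm]
  rw [integral_finsetSum _ fun _ _ => .of_finite]
  refine (Finset.sum_le_sum fun y _ => hpoint y).trans_eq ?_
  rw [Finset.sum_add_distrib, ← Finset.sum_mul, ← Finset.sum_mul, sum_measureReal_singleton_univ,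
    one_mul, ← tv_eq_sum_max]

lemma measureReal_le_flatNorm_le [NeZero m] (P r : Measure Y) [IsProbabilityMeasure P]
    [IsProbabilityMeasure r] (hm : Fintype.card Y ≤ m) :
    (Measure.pi fun _ : Fin m => P).real {s | 600 / Fintype.card Y ≤ flatNorm P r s} ≤ 1 / 200 := by
  have : Nonempty Y := P.nonempty_of_neZero
  have hcard : (0 : ℝ) < Fintype.card Y := by exact_mod_cast Fintype.card_pos
  have hinv : (m : ℝ)⁻¹ ≤ (Fintype.card Y : ℝ)⁻¹ := by gcongr
  have hmarkov := mul_meas_ge_le_integral_of_nonneg (μ := Measure.pi fun _ : Fin m => P)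
    (f := flatNorm P r) (.of_forall (flatNorm_nonneg P r)) .of_finite (600 / Fintype.card Y)
  have hmean : ∫ s : Fin m → Y, flatNorm P r s ∂Measure.pi (fun _ => P) ≤
      3 * (Fintype.card Y : ℝ)⁻¹ := by
    refine (integral_flatNorm_le P r).trans ?_
    nlinarith [tv_le_one P r, inv_pos.2 hcard, inv_nonneg.2 (Nat.cast_nonneg (α := ℝ) m)]
  refine le_of_mul_le_mul_left (hmarkov.trans (hmean.trans_eq ?_)) (by positivity)
  field_simp
  norm_num

end Flattening

section BlockTester

lemma measureReal_prod_and_le {A B : Type*} [Finite A] [Finite B] [MeasurableSpace A]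
    [MeasurableSpace B] [MeasurableSingletonClass A] [MeasurableSingletonClass B] {μ : Measure A}
    {ν : Measure B} [IsProbabilityMeasure μ] [IsProbabilityMeasure ν] {E : A → Prop}
    {F : A × B → Prop} {η : ℝ} (hη : 0 ≤ η) (h : ∀ a, E a → ν.real {b | F (a, b)} ≤ η) :
    (μ.prod ν).real {t | E t.1 ∧ F t} ≤ η := by
  have hsection (a : A) : ν.real (Prod.mk a ⁻¹' {t : A × B | E t.1 ∧ F t}) ≤ η := by
    by_cases ha : E a
    · simpa only [Set.preimage_ofPred_eq, ha, true_and] using h a ha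
    · simpa only [Set.preimage_ofPred_eq, ha, false_and, Set.ofPred_false, measureReal_empty]
        using hη
  refine ENNReal.toReal_le_of_le_ofReal hη ?_
  rw [Measure.prod_apply (Set.toFinite _).measurableSet]
  calc _ ≤ ∫⁻ _, ENNReal.ofReal η ∂μ := lintegral_mono fun a =>
        ENNReal.le_ofReal_iff_toReal_le (measure_ne_top _ _) hη |>.2 (hsection a)
    _ = ENNReal.ofReal η := by rw [lintegral_const, measure_univ, mul_one]

variable {X Y W : Type*} [MeasurableSpace X] [MeasurableSpace Y] [MeasurableSpace W]

/-- The product of the marginals of a distribution on a product of three blocks. -/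
noncomputable def prodMarginals (P : Measure (X × Y × W)) : Measure (X × Y × W) :=
  P.fst.prod (P.snd.fst.prod P.snd.snd)

instance (P : Measure (X × Y × W)) [IsProbabilityMeasure P] :
    IsProbabilityMeasure (prodMarginals P) := by
  unfold prodMarginals
  infer_instance

/-- The observations of the block tester: one batch of draws, for flattening and for learning the
outer marginals, and two batches of pairs for the cross statistics. -/
abbrev Batches (m : ℕ) (T : Type*) : Type _ := (Fin m → T) × ((Fin m → T × T) × (Fin m → T × T))

/-- The law of the observations: the second component of each pair is a draw from the product of
the marginals. -/
noncomputable def batchLaw (m : ℕ) (P : Measure (X × Y × W)) : Measure (Batches m (X × Y × W)) :=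
  (Measure.pi fun _ => P).prod
    ((Measure.pi fun _ => P.prod (prodMarginals P)).prod
      (Measure.pi fun _ => P.prod (prodMarginals P)))

instance {m : ℕ} (P : Measure (X × Y × W)) [IsProbabilityMeasure P] :
    IsProbabilityMeasure (batchLaw m P) := by
  unfold batchLaw
  infer_instance

lemma measureReal_batchLaw_comp {m : ℕ} {V : Type*} [MeasurableSpace V] [Finite V]
    [MeasurableSingletonClass V] {P : Measure (X × Y × W)} [IsProbabilityMeasure P] {Q : Measure V}
    [IsProbabilityMeasure Q] {π : X × Y × W → V} (hπ : MeasurePreserving π P Q)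
    (E : Set (Fin m → V)) :
    (batchLaw m P).real {t | π ∘ t.1 ∈ E} = (Measure.pi fun _ => Q).real E :=
  ((measurePreserving_pi _ _ fun _ => hπ).comp
    measurePreserving_fst).measureReal_preimage (Set.toFinite E).measurableSet.nullMeasurableSet

lemma measurePreserving_left (P : Measure (X × Y × W)) : MeasurePreserving Prod.fst P P.fst :=
  measurable_fst.measurePreserving P

lemma measurePreserving_mid (P : Measure (X × Y × W)) :
    MeasurePreserving (Prod.fst ∘ Prod.snd) P P.snd.fst :=
  (measurable_fst.measurePreserving P.snd).comp (measurable_snd.measurePreserving P)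

lemma measurePreserving_right (P : Measure (X × Y × W)) :
    MeasurePreserving (Prod.snd ∘ Prod.snd) P P.snd.snd :=
  (measurable_snd.measurePreserving P.snd).comp (measurable_snd.measurePreserving P)

lemma map_prod_prodMarginals_mid (P : Measure (X × Y × W)) [IsProbabilityMeasure P] :
    (P.prod (prodMarginals P)).map (fun u => u.1.2.1) = P.snd.fst :=
  ((measurePreserving_mid P).comp measurePreserving_fst).map_eq

variable [Fintype Y] {m : ℕ}

/-- The estimate of the squared norm of the flattened middle marginal. -/
noncomputable def midNormStat (r : Measure (X × Y × W)) (t : Batches m (X × Y × W)) : ℝ :=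
  normStat (fun y => (buckets r.snd.fst (Prod.fst ∘ Prod.snd ∘ t.1) y)⁻¹) (fun u => u.1.2.1) t.2

lemma midNormStat_nonneg (r : Measure (X × Y × W)) (t : Batches m (X × Y × W)) :
    0 ≤ midNormStat r t :=
  normStat_nonneg (fun y => inv_nonneg.2 (buckets_pos _ _ y).le) _ _

lemma integral_midNormStat [Finite X] [Finite W] [MeasurableSingletonClass X]
    [MeasurableSingletonClass Y] [MeasurableSingletonClass W] [NeZero m]
    (P r : Measure (X × Y × W)) [IsProbabilityMeasure P] :
    ∫ t, midNormStat r t ∂batchLaw m P =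
      ∫ s : Fin m → Y, flatNorm P.snd.fst r.snd.fst s ∂Measure.pi fun _ => P.snd.fst := by
  rw [batchLaw, integral_prod _ .of_finite,
    ← (measurePreserving_pi _ _ fun _ => measurePreserving_mid P).map_eq,
    integral_map (measurable_of_finite _).aemeasurable .of_discrete]
  simp only [midNormStat, integral_normStat, map_prod_prodMarginals_mid]
  rfl

variable [Fintype X] [Fintype W]

/-- The number of buckets of a point of the product: the product over the three blocks. -/
noncomputable def blockBuckets (r : Measure (X × Y × W)) (s : Fin m → X × Y × W) (z : X × Y × W) :
    ℝ :=
  buckets r.fst (Prod.fst ∘ s) z.1 *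
    (buckets r.snd.fst (Prod.fst ∘ Prod.snd ∘ s) z.2.1 *
      buckets r.snd.snd (Prod.snd ∘ Prod.snd ∘ s) z.2.2)

lemma one_le_blockBuckets (r : Measure (X × Y × W)) (s : Fin m → X × Y × W) (z : X × Y × W) :
    1 ≤ blockBuckets r s z :=
  one_le_mul_of_one_le_of_one_le (one_le_buckets _ _ _)
    (one_le_mul_of_one_le_of_one_le (one_le_buckets _ _ _) (one_le_buckets _ _ _))

lemma inv_blockBuckets_nonneg (r : Measure (X × Y × W)) (s : Fin m → X × Y × W) (z : X × Y × W) :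
    0 ≤ (blockBuckets r s z)⁻¹ :=
  inv_nonneg.2 (zero_le_one.trans (one_le_blockBuckets r s z))

lemma inv_blockBuckets_le_one (r : Measure (X × Y × W)) (s : Fin m → X × Y × W) (z : X × Y × W) :
    (blockBuckets r s z)⁻¹ ≤ 1 :=
  inv_le_one_of_one_le₀ (one_le_blockBuckets r s z)

lemma sum_inv_blockBuckets_mul_sq (P r : Measure (X × Y × W)) [IsProbabilityMeasure P]
    (s : Fin m → X × Y × W) :
    ∑ z, (blockBuckets r s z)⁻¹ * (prodMarginals P).real {z} ^ 2 =
      flatNorm P.fst r.fst (Prod.fst ∘ s) *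
        (flatNorm P.snd.fst r.snd.fst (Prod.fst ∘ Prod.snd ∘ s) *
          flatNorm P.snd.snd r.snd.snd (Prod.snd ∘ Prod.snd ∘ s)) := by
  have hpoint (a b c a' b' c' : ℝ) : (a * (b * c))⁻¹ * (a' * (b' * c')) ^ 2 =
      a⁻¹ * a' ^ 2 * (b⁻¹ * b' ^ 2 * (c⁻¹ * c' ^ 2)) := by
    rw [mul_inv, mul_inv]
    ring
  simp only [blockBuckets, prodMarginals, prod_measureReal_singleton, hpoint, flatNorm,
    Fintype.sum_prod_type, ← Finset.mul_sum, ← Finset.sum_mul]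

/-- The estimate of the squared flattened distance from the product of the marginals. -/
noncomputable def blockDistStat (r : Measure (X × Y × W)) (t : Batches m (X × Y × W)) : ℝ :=
  distStat (fun z => (blockBuckets r t.1 z)⁻¹) t.2

variable [MeasurableSingletonClass X] [MeasurableSingletonClass Y] [MeasurableSingletonClass W]

lemma sum_blockBuckets [NeZero m] (r : Measure (X × Y × W)) [IsProbabilityMeasure r]
    (s : Fin m → X × Y × W) : ∑ z, blockBuckets r s z = 27 * Fintype.card (X × Y × W) := by
  simp only [blockBuckets, Fintype.sum_prod_type, ← Finset.mul_sum, ← Finset.sum_mul, sum_buckets,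
    Fintype.card_prod, Nat.cast_mul]
  ring

end BlockTester

section EnoughSamples

/-- A bound for the expected squared norm of the flattened middle marginal when the prediction is
`α`-accurate. -/
noncomputable def normBound (Y : Type*) [Fintype Y] (m : ℕ) (α : ℝ) : ℝ :=
  2 / Fintype.card Y + α / m

/-- The threshold for the distance statistic: half of what Cauchy–Schwarz guarantees at total
variation distance `ε / 2` from the product of the marginals. -/
noncomputable def distBound (T : Type*) [Fintype T] (ε : ℝ) : ℝ :=
  ε ^ 2 / (54 * Fintype.card T)

/-- The parameter regime in which the block tester is analysed. -/
structure EnoughSamples (X Y W : Type*) [Fintype X] [Fintype Y] [Fintype W] (m : ℕ) (α ε : ℝ) :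
    Prop where
  eps_pos : 0 < ε
  eps_le : ε ≤ 1
  alpha_nonneg : 0 ≤ α
  card_left : (Fintype.card X : ℝ) ^ 2 ≤ Fintype.card (X × Y × W)
  card_right : (Fintype.card W : ℝ) ^ 2 ≤ Fintype.card (X × Y × W)
  le_sq : 10 ^ 20 * (Fintype.card (X × Y × W) : ℝ) ≤ m ^ 2 * ε ^ 4
  le_cube : 10 ^ 20 * (Fintype.card Y * Fintype.card (X × Y × W) * α) ≤ m ^ 3 * ε ^ 4

variable {X Y W : Type*} [Fintype X] [Fintype Y] [Fintype W] {m : ℕ} {α ε : ℝ}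

lemma distBound_pos [Nonempty X] (hε : 0 < ε) : 0 < distBound X ε := by
  have : (0 : ℝ) < Fintype.card X := by exact_mod_cast Fintype.card_pos
  unfold distBound
  positivity

lemma normBound_pos [Nonempty Y] (hα : 0 ≤ α) : 0 < normBound Y m α := by
  have : (0 : ℝ) < Fintype.card Y := by exact_mod_cast Fintype.card_pos
  unfold normBound
  positivity

lemma EnoughSamples.le_mul_sq (h : EnoughSamples X Y W m α ε) {n : ℝ}
    (hn : n ^ 2 ≤ Fintype.card (X × Y × W)) : 10 ^ 10 * n ≤ m * ε ^ 2 := by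
  refine (abs_le_of_sq_le_sq' ?_ (by positivity)).2
  linarith [h.le_sq]

lemma EnoughSamples.le_of_sq_le (h : EnoughSamples X Y W m α ε) {n : ℝ}
    (hn : n ^ 2 ≤ Fintype.card (X × Y × W)) : n ≤ m := by
  have hm : (m : ℝ) * ε ^ 2 ≤ m :=
    mul_le_of_le_one_right m.cast_nonneg (pow_le_one₀ h.eps_pos.le h.eps_le)
  obtain hn₀ | hn₀ := le_total n 0
  · exact hn₀.trans m.cast_nonneg
  · linarith [h.le_mul_sq hn, hn₀]

lemma EnoughSamples.card_mul_le (h : EnoughSamples X Y W m α ε) :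
    10 ^ 20 * (Fintype.card (X × Y × W) : ℝ) ≤ m ^ 2 * ε ^ 2 := by
  refine h.le_sq.trans ?_
  gcongr 1
  exact pow_le_pow_of_le_one h.eps_pos.le h.eps_le (by norm_num)

lemma EnoughSamples.card_mid_le [Nonempty X] [Nonempty W] (h : EnoughSamples X Y W m α ε) :
    10 ^ 20 * (Fintype.card Y : ℝ) ≤ m ^ 2 := by
  have hcard : Fintype.card Y ≤ Fintype.card (X × Y × W) := by
    rw [Fintype.card_prod, Fintype.card_prod]
    exact (Nat.le_mul_of_pos_right _ Fintype.card_pos).trans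
      (Nat.le_mul_of_pos_left _ Fintype.card_pos)
  calc 10 ^ 20 * (Fintype.card Y : ℝ) ≤ 10 ^ 20 * (Fintype.card (X × Y × W) : ℝ) := by gcongr
    _ ≤ m ^ 2 * ε ^ 2 := h.card_mul_le
    _ ≤ m ^ 2 := mul_le_of_le_one_right (sq_nonneg _) (pow_le_one₀ h.eps_pos.le h.eps_le)

variable [Nonempty X] [Nonempty Y] [Nonempty W]

lemma EnoughSamples.one_le_sq_mul_normBound (h : EnoughSamples X Y W m α ε) :
    1 ≤ ((m : ℝ) / 10000) ^ 2 * (20 * normBound Y m α) := by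
  have hcard : (0 : ℝ) < Fintype.card Y := by exact_mod_cast Fintype.card_pos
  have hle : 2 / (Fintype.card Y : ℝ) ≤ normBound Y m α :=
    le_add_of_nonneg_right (div_nonneg h.alpha_nonneg m.cast_nonneg)
  calc 1 ≤ (m : ℝ) ^ 2 * 40 / 10 ^ 8 / Fintype.card Y := by
        rw [one_le_div hcard]
        linarith [h.card_mid_le]
    _ = (m / 10000) ^ 2 * (20 * (2 / Fintype.card Y)) := by ring
    _ ≤ _ := by gcongr

lemma EnoughSamples.one_le_sq_mul_distBound (h : EnoughSamples X Y W m α ε) :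
    1 ≤ ((m : ℝ) / 10000) ^ 2 * (2 * distBound (X × Y × W) ε) := by
  have hcard : (0 : ℝ) < Fintype.card (X × Y × W) := by exact_mod_cast Fintype.card_pos
  calc 1 ≤ (m : ℝ) ^ 2 * ε ^ 2 / (27 * 10 ^ 8 * Fintype.card (X × Y × W)) := by
        rw [one_le_div (by positivity)]
        linarith [h.card_mul_le]
    _ = _ := by
        unfold distBound
        ring

lemma EnoughSamples.norm_mul_le [NeZero m] (h : EnoughSamples X Y W m α ε) {p q r : ℝ}
    (hq₀ : 0 ≤ q) (hr₀ : 0 ≤ r) (hp : p < 600 / Fintype.card X) (hq : q < 40 * normBound Y m α)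
    (hr : r < 600 / Fintype.card W) :
    p * (q * r) ≤ (m * distBound (X × Y × W) ε / 10000) ^ 2 := by
  have hX : (0 : ℝ) < Fintype.card X := by exact_mod_cast Fintype.card_pos
  have hY : (0 : ℝ) < Fintype.card Y := by exact_mod_cast Fintype.card_pos
  have hW : (0 : ℝ) < Fintype.card W := by exact_mod_cast Fintype.card_pos
  have hm : (0 : ℝ) < m := by exact_mod_cast NeZero.pos m
  have hα := h.alpha_nonneg
  have hsq := h.le_sq
  have hcube : 10 ^ 20 * (Fintype.card Y * Fintype.card (X × Y × W) * α / m) ≤ m ^ 2 * ε ^ 4 := by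
    rw [← mul_div_assoc, div_le_iff₀ hm]
    linarith [h.le_cube]
  simp only [normBound, distBound, Fintype.card_prod, Nat.cast_mul] at *
  set a : ℝ := (Fintype.card X : ℝ)
  set b : ℝ := (Fintype.card Y : ℝ)
  set c : ℝ := (Fintype.card W : ℝ)
  calc p * (q * r) ≤ 600 / a * (40 * (2 / b + α / m) * (600 / c)) := by gcongr
    _ = 14400000 / (a * (b * c)) ^ 2 * (2 * (a * (b * c)) + b * (a * (b * c)) * α / m) := by
      field_simp
      ring
    _ ≤ 14400000 / (a * (b * c)) ^ 2 * (3 / 10 ^ 20 * (m ^ 2 * ε ^ 4)) := by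
      gcongr
      linarith
    _ ≤ 1 / (54 ^ 2 * 10000 ^ 2) / (a * (b * c)) ^ 2 * (m ^ 2 * ε ^ 4) := by
      rw [← mul_assoc, div_mul_eq_mul_div]
      gcongr
      norm_num
    _ = _ := by field_simp

end EnoughSamples

section BlockTesterAnalysis

variable {X Y W : Type*} [Fintype X] [Fintype Y] [Fintype W] [MeasurableSpace X]
  [MeasurableSpace Y] [MeasurableSpace W] {m : ℕ} {α ε : ℝ}

/-- The flattened marginals have small norm. -/
def FlatSample (α : ℝ) (P r : Measure (X × Y × W)) (s : Fin m → X × Y × W) : Prop :=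
  flatNorm P.fst r.fst (Prod.fst ∘ s) < 600 / Fintype.card X ∧
    flatNorm P.snd.fst r.snd.fst (Prod.fst ∘ Prod.snd ∘ s) < 40 * normBound Y m α ∧
    flatNorm P.snd.snd r.snd.snd (Prod.snd ∘ Prod.snd ∘ s) < 600 / Fintype.card W

open Classical in
/-- The tester for three blocks. The classes `𝒜` and `ℬ` consist of the distributions that are
admissible as marginals on the outer blocks. -/
noncomputable def blockTester (α ε : ℝ) (𝒜 : Set (Measure X)) (ℬ : Set (Measure W))
    (r : Measure (X × Y × W)) (t : Batches m (X × Y × W)) : Answer :=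
  if 20 * normBound Y m α ≤ midNormStat r t then Answer.inaccurateInformation
  else if distBound (X × Y × W) ε ≤ blockDistStat r t ∨
      (∀ a ∈ 𝒜, ε / 8 ≤ tv (empirical (Prod.fst ∘ t.1)) a) ∨
      ∀ b ∈ ℬ, ε / 8 ≤ tv (empirical (Prod.snd ∘ Prod.snd ∘ t.1)) b then Answer.reject
  else Answer.accept

lemma blockTester_eq_accept {𝒜 : Set (Measure X)} {ℬ : Set (Measure W)}
    {r : Measure (X × Y × W)} {t : Batches m (X × Y × W)}
    (ht : blockTester α ε 𝒜 ℬ r t = Answer.accept) :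
    blockDistStat r t < distBound (X × Y × W) ε ∧
      (∃ a ∈ 𝒜, tv (empirical (Prod.fst ∘ t.1)) a < ε / 8) ∧
        ∃ b ∈ ℬ, tv (empirical (Prod.snd ∘ Prod.snd ∘ t.1)) b < ε / 8 := by
  simp only [blockTester] at ht
  split_ifs at ht with hnorm hreject
  simpa only [not_or, not_le, not_forall, exists_prop] using hreject

lemma le_tv_of_le_tv_of_lt {V : Type*} [Fintype V] [MeasurableSpace V]
    {μ ν ρ : Measure V} (hν : ε / 4 ≤ tv μ ν) (hρ : tv ρ ν < ε / 8) :
    ε / 8 ≤ tv ρ μ := by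
  have htriangle := tv_triangle μ ρ ν
  rw [tv_comm μ ρ] at htriangle
  linarith

lemma FlatSample.sum_inv_blockBuckets_le [Nonempty X] [Nonempty Y] [Nonempty W] [NeZero m]
    {P r : Measure (X × Y × W)} [IsProbabilityMeasure P] {s : Fin m → X × Y × W}
    (hs : FlatSample α P r s) (h : EnoughSamples X Y W m α ε) :
    ∑ z, (blockBuckets r s z)⁻¹ * (prodMarginals P).real {z} ^ 2 ≤
      (m * distBound (X × Y × W) ε / 10000) ^ 2 := by
  rw [sum_inv_blockBuckets_mul_sq]
  exact h.norm_mul_le (flatNorm_nonneg _ _ _) (flatNorm_nonneg _ _ _) hs.1 hs.2.1 hs.2.2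

lemma two_mul_distBound_le [MeasurableSingletonClass X] [MeasurableSingletonClass Y]
    [MeasurableSingletonClass W] [NeZero m] {P r : Measure (X × Y × W)} [IsProbabilityMeasure r]
    (hε : 0 ≤ ε) (hfar : ε / 2 ≤ tv P (prodMarginals P)) (s : Fin m → X × Y × W) :
    2 * distBound (X × Y × W) ε ≤
      ∑ z, (blockBuckets r s z)⁻¹ * (P.real {z} - (prodMarginals P).real {z}) ^ 2 := by
  have hcs := Finset.sq_sum_div_le_sum_sq_div Finset.univ
    (fun z => |P.real {z} - (prodMarginals P).real {z}|) (g := blockBuckets r s)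
    fun z _ => zero_lt_one.trans_le (one_le_blockBuckets r s z)
  simp only [sum_blockBuckets, sq_abs, div_eq_inv_mul _ (blockBuckets r s _)] at hcs
  refine le_trans ?_ hcs
  calc _ = ε ^ 2 / (27 * Fintype.card (X × Y × W)) := by
        unfold distBound
        ring
    _ ≤ _ := by
        gcongr
        rw [tv] at hfar
        linarith

variable [NeZero m] {P r : Measure (X × Y × W)} [IsProbabilityMeasure P]

lemma EnoughSamples.measureReal_le_flatNorm_comp_le (h : EnoughSamples X Y W m α ε) {V : Type*}
    [Fintype V] [MeasurableSpace V] [MeasurableSingletonClass V] {Q q : Measure V}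
    [IsProbabilityMeasure Q] [IsProbabilityMeasure q] {π : X × Y × W → V}
    (hπ : MeasurePreserving π P Q) (hV : (Fintype.card V : ℝ) ^ 2 ≤ Fintype.card (X × Y × W)) :
    (batchLaw m P).real {t | 600 / Fintype.card V ≤ flatNorm Q q (π ∘ t.1)} ≤ 1 / 200 :=
  (measureReal_batchLaw_comp hπ {s | 600 / Fintype.card V ≤ flatNorm Q q s}).trans_le
    (measureReal_le_flatNorm_le Q q (by exact_mod_cast h.le_of_sq_le hV))

lemma EnoughSamples.measureReal_le_tv_empirical_comp_le (h : EnoughSamples X Y W m α ε)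
    {V : Type*} [Fintype V] [MeasurableSpace V] [MeasurableSingletonClass V] {Q : Measure V}
    [IsProbabilityMeasure Q] {π : X × Y × W → V} (hπ : MeasurePreserving π P Q)
    (hV : (Fintype.card V : ℝ) ^ 2 ≤ Fintype.card (X × Y × W)) :
    (batchLaw m P).real {t | ε / 8 ≤ tv (empirical (π ∘ t.1)) Q} ≤ 1 / 200 := by
  have hε := h.eps_pos
  refine (measureReal_batchLaw_comp hπ {s | ε / 8 ≤ tv (empirical s) Q}).trans_le
    (measureReal_le_tv_empirical_le Q (by positivity) ?_)
  have hm := h.le_mul_sq hV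
  linarith [(Fintype.card V).cast_nonneg (α := ℝ)]

variable [MeasurableSingletonClass X] [MeasurableSingletonClass Y] [MeasurableSingletonClass W]

lemma EnoughSamples.measureReal_dist_overestimated_le (h : EnoughSamples X Y W m α ε)
    (hind : P = prodMarginals P) :
    (batchLaw m P).real {t | FlatSample α P r t.1 ∧
      distBound (X × Y × W) ε ≤ blockDistStat r t} ≤ 1 / 200 := by
  obtain ⟨_, _, _⟩ : Nonempty X ∧ Nonempty Y ∧ Nonempty W := by
    simpa only [nonempty_prod] using P.nonempty_of_neZero
  have hlaw : P.prod (prodMarginals P) = (prodMarginals P).prod (prodMarginals P) :=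
    congrArg (·.prod (prodMarginals P)) hind
  rw [batchLaw, hlaw]
  refine measureReal_prod_and_le (η := 1 / 200) (E := FlatSample α P r)
    (F := fun t => distBound (X × Y × W) ε ≤ blockDistStat r t) (by norm_num) fun s hs => ?_
  simp only [blockDistStat]
  refine measureReal_le_distStat_le (inv_blockBuckets_nonneg r s) (inv_blockBuckets_le_one r s)
    (distBound_pos h.eps_pos) ?_
  rw [Fintype.card_fin]
  exact hs.sum_inv_blockBuckets_le h

lemma EnoughSamples.measureReal_norm_underestimated_le (h : EnoughSamples X Y W m α ε) :
    (batchLaw m P).real {t | 40 * normBound Y m α ≤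
      flatNorm P.snd.fst r.snd.fst (Prod.fst ∘ Prod.snd ∘ t.1) ∧
        midNormStat r t < 20 * normBound Y m α} ≤ 1 / 200 := by
  obtain ⟨_, _, _⟩ : Nonempty X ∧ Nonempty Y ∧ Nonempty W := by
    simpa only [nonempty_prod] using P.nonempty_of_neZero
  have hpos : 0 < normBound Y m α := normBound_pos h.alpha_nonneg
  rw [batchLaw]
  refine measureReal_prod_and_le (η := 1 / 200)
    (E := fun s => 40 * normBound Y m α ≤ flatNorm P.snd.fst r.snd.fst (Prod.fst ∘ Prod.snd ∘ s))
    (F := fun t => midNormStat r t < 20 * normBound Y m α) (by norm_num) fun s hs => ?_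
  simp only [midNormStat]
  refine measureReal_normStat_lt_le (ι := Fin m) (μ := P.prod (prodMarginals P))
    (w := fun y => (buckets r.snd.fst (Prod.fst ∘ Prod.snd ∘ s) y)⁻¹)
    (q := 20 * normBound Y m α) (fun y => inv_nonneg.2 (buckets_pos _ _ y).le)
    (fun y => inv_le_one_of_one_le₀ (one_le_buckets _ _ y)) (fun u => u.1.2.1)
    (mul_pos (by norm_num) hpos) ?_ ?_
  · rw [map_prod_prodMarginals_mid]
    exact (Eq.le (by ring)).trans hs
  · rw [Fintype.card_fin]
    exact h.one_le_sq_mul_normBound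

variable [IsProbabilityMeasure r]

lemma integral_midNormStat_le (hα : tv P r ≤ α) :
    ∫ t, midNormStat r t ∂batchLaw m P ≤ normBound Y m α := by
  have htv : tv P.snd.fst r.snd.fst ≤ α :=
    (tv_map_le P.snd r.snd Prod.fst).trans ((tv_map_le P r Prod.snd).trans hα)
  rw [integral_midNormStat]
  calc _ ≤ (Fintype.card Y : ℝ)⁻¹ +
        tv P.snd.fst r.snd.fst * ((m : ℝ)⁻¹ + (Fintype.card Y : ℝ)⁻¹) := integral_flatNorm_le _ _
    _ = (Fintype.card Y : ℝ)⁻¹ + tv P.snd.fst r.snd.fst * (Fintype.card Y : ℝ)⁻¹ +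
        tv P.snd.fst r.snd.fst * (m : ℝ)⁻¹ := by ring
    _ ≤ (Fintype.card Y : ℝ)⁻¹ + 1 * (Fintype.card Y : ℝ)⁻¹ + α * (m : ℝ)⁻¹ := by
        gcongr
        exact tv_le_one _ _
    _ = _ := by
        unfold normBound
        ring

lemma EnoughSamples.measureReal_inaccurate_le (h : EnoughSamples X Y W m α ε) (hα : tv P r ≤ α) :
    (batchLaw m P).real {t | 20 * normBound Y m α ≤ midNormStat r t} ≤ 1 / 20 := by
  have : Nonempty Y := P.snd.fst.nonempty_of_neZero
  have hpos : 0 < normBound Y m α := normBound_pos h.alpha_nonneg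
  have hmarkov := mul_meas_ge_le_integral_of_nonneg (μ := batchLaw m P)
    (.of_forall (midNormStat_nonneg r)) .of_finite (20 * normBound Y m α)
  refine le_of_mul_le_mul_left (hmarkov.trans ((integral_midNormStat_le hα).trans_eq ?_))
    (mul_pos (by norm_num) hpos)
  ring

lemma EnoughSamples.measureReal_not_flatSample_le (h : EnoughSamples X Y W m α ε) :
    (batchLaw m P).real {t | midNormStat r t < 20 * normBound Y m α ∧ ¬ FlatSample α P r t.1} ≤
      3 / 200 := by
  have hleft := h.measureReal_le_flatNorm_comp_le (q := r.fst) (measurePreserving_left P)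
    h.card_left
  have hmid := h.measureReal_norm_underestimated_le (P := P) (r := r)
  have hright := h.measureReal_le_flatNorm_comp_le (q := r.snd.snd) (measurePreserving_right P)
    h.card_right
  refine (measureReal_mono ?_).trans (measureReal_union_le _ _ |>.trans (add_le_add hleft
    (measureReal_union_le _ _ |>.trans (add_le_add hmid hright)))) |>.trans (by norm_num)
  rintro t ⟨hnorm, hflat⟩
  by_contra hcon
  simp only [Set.mem_union, Set.mem_ofPred_eq, not_or, not_and, not_le, not_lt] at hcon
  exact hflat ⟨hcon.1, not_le.1 fun hge => (hcon.2.1 hge).not_gt hnorm, hcon.2.2⟩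

lemma EnoughSamples.measureReal_dist_underestimated_le (h : EnoughSamples X Y W m α ε)
    (hfar : ε / 2 ≤ tv P (prodMarginals P)) :
    (batchLaw m P).real {t | FlatSample α P r t.1 ∧
      blockDistStat r t < distBound (X × Y × W) ε} ≤ 1 / 200 := by
  obtain ⟨_, _, _⟩ : Nonempty X ∧ Nonempty Y ∧ Nonempty W := by
    simpa only [nonempty_prod] using P.nonempty_of_neZero
  rw [batchLaw]
  refine measureReal_prod_and_le (η := 1 / 200) (E := FlatSample α P r)
    (F := fun t => blockDistStat r t < distBound (X × Y × W) ε) (by norm_num) fun s hs => ?_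
  have hdist := two_mul_distBound_le h.eps_pos.le hfar s (r := r)
  simp only [blockDistStat]
  refine measureReal_distStat_lt_le (inv_blockBuckets_nonneg r s) (inv_blockBuckets_le_one r s)
    (distBound_pos h.eps_pos) ?_ hdist ?_ <;> rw [Fintype.card_fin]
  · exact hs.sum_inv_blockBuckets_le h
  · exact h.one_le_sq_mul_distBound.trans (by gcongr)

lemma EnoughSamples.blockTester_accurate (h : EnoughSamples X Y W m α ε) (hα : tv P r ≤ α)
    (𝒜 : Set (Measure X)) (ℬ : Set (Measure W)) :
    (batchLaw m P).real {t | blockTester α ε 𝒜 ℬ r t = Answer.inaccurateInformation} ≤ 1 / 20 := by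
  refine (measureReal_mono fun t ht => ?_).trans (h.measureReal_inaccurate_le hα)
  simp only [blockTester, Set.mem_ofPred_eq] at ht
  split_ifs at ht with hnorm
  exact hnorm

lemma EnoughSamples.blockTester_product (h : EnoughSamples X Y W m α ε) {𝒜 : Set (Measure X)}
    {ℬ : Set (Measure W)} (hind : P = prodMarginals P) (h𝒜 : P.fst ∈ 𝒜) (hℬ : P.snd.snd ∈ ℬ) :
    (batchLaw m P).real {t | blockTester α ε 𝒜 ℬ r t = Answer.reject} ≤ 1 / 20 := by
  have hflat := h.measureReal_not_flatSample_le (P := P) (r := r)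
  have hdist := h.measureReal_dist_overestimated_le hind (r := r)
  have hleft := h.measureReal_le_tv_empirical_comp_le (measurePreserving_left P) h.card_left
  have hright := h.measureReal_le_tv_empirical_comp_le (measurePreserving_right P) h.card_right
  refine (measureReal_mono ?_).trans (measureReal_union_le _ _ |>.trans (add_le_add hflat
    (measureReal_union_le _ _ |>.trans (add_le_add hdist (measureReal_union_le _ _ |>.trans
      (add_le_add hleft hright)))))) |>.trans (by norm_num)
  intro t ht
  simp only [blockTester, Set.mem_ofPred_eq] at ht
  split_ifs at ht with hnorm hreject
  by_cases hs : FlatSample α P r t.1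
  · obtain hreject | hreject | hreject := hreject
    · exact .inr (.inl ⟨hs, hreject⟩)
    · exact .inr (.inr (.inl (hreject _ h𝒜)))
    · exact .inr (.inr (.inr (hreject _ hℬ)))
  · exact .inl ⟨not_le.1 hnorm, hs⟩

lemma EnoughSamples.measureReal_accept_le (h : EnoughSamples X Y W m α ε) {𝒜 : Set (Measure X)}
    {ℬ : Set (Measure W)} {E : Set (Batches m (X × Y × W))}
    (hE : (batchLaw m P).real E ≤ 1 / 200)
    (hsub : ∀ t, FlatSample α P r t.1 → blockTester α ε 𝒜 ℬ r t = Answer.accept → t ∈ E) :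
    (batchLaw m P).real {t | blockTester α ε 𝒜 ℬ r t = Answer.accept} ≤ 1 / 20 := by
  have hflat := h.measureReal_not_flatSample_le (P := P) (r := r)
  refine (measureReal_mono fun t (ht : _ = _) => ?_).trans
    (measureReal_union_le _ _ |>.trans (add_le_add hflat hE)) |>.trans (by norm_num)
  by_cases hs : FlatSample α P r t.1
  · exact .inr (hsub t hs ht)
  · refine .inl ⟨?_, hs⟩
    simp only [blockTester] at ht
    split_ifs at ht with hnorm
    exact not_le.1 hnorm

lemma EnoughSamples.blockTester_far (h : EnoughSamples X Y W m α ε) {𝒜 : Set (Measure X)}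
    {ℬ : Set (Measure W)} (hfar : ε / 2 ≤ tv P (prodMarginals P) ∨
      (∀ a ∈ 𝒜, ε / 4 ≤ tv P.fst a) ∨ ∀ b ∈ ℬ, ε / 4 ≤ tv P.snd.snd b) :
    (batchLaw m P).real {t | blockTester α ε 𝒜 ℬ r t = Answer.accept} ≤ 1 / 20 := by
  obtain hfar | hfar | hfar := hfar
  · exact h.measureReal_accept_le (h.measureReal_dist_underestimated_le hfar) fun t hs ht =>
      ⟨hs, (blockTester_eq_accept ht).1⟩
  · refine h.measureReal_accept_le
      (h.measureReal_le_tv_empirical_comp_le (measurePreserving_left P) h.card_left)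
      fun t _ ht => ?_
    obtain ⟨a, ha, hlt⟩ := (blockTester_eq_accept ht).2.1
    exact le_tv_of_le_tv_of_lt (hfar a ha) hlt
  · refine h.measureReal_accept_le
      (h.measureReal_le_tv_empirical_comp_le (measurePreserving_right P) h.card_right)
      fun t _ ht => ?_
    obtain ⟨b, hb, hlt⟩ := (blockTester_eq_accept ht).2.2
    exact le_tv_of_le_tv_of_lt (hfar b hb) hlt

end BlockTesterAnalysis

section Simulable

variable {Ω S S' : Type*} [MeasurableSpace Ω] [MeasurableSpace S] [MeasurableSpace S']

/-- The law `V P` is the law of a fixed statistic of `M` independent draws from `P`. -/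
def Simulable (M : ℕ) (V : Measure Ω → Measure S) : Prop :=
  ∃ φ : (Fin M → Ω) → S, ∀ (P : Measure Ω) [IsProbabilityMeasure P],
    MeasurePreserving φ (Measure.pi fun _ => P) (V P)

lemma Simulable.isProbabilityMeasure {M : ℕ} {V : Measure Ω → Measure S} (h : Simulable M V)
    (P : Measure Ω) [IsProbabilityMeasure P] : IsProbabilityMeasure (V P) := by
  obtain ⟨φ, hφ⟩ := h
  rw [← (hφ P).map_eq]
  exact Measure.isProbabilityMeasure_map (hφ P).measurable.aemeasurable

lemma simulable_card {ι : Type*} [Fintype ι] {V : Measure Ω → Measure S} (φ : (ι → Ω) → S)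
    (hφ : ∀ (P : Measure Ω) [IsProbabilityMeasure P],
      MeasurePreserving φ (Measure.pi fun _ => P) (V P)) :
    Simulable (Fintype.card ι) V :=
  ⟨_, fun P _ => (hφ P).comp (measurePreserving_arrowCongr' _ _ (Fintype.equivFin ι).symm
    (MeasurableEquiv.refl Ω) fun _ => .id P)⟩

lemma simulable_id : Simulable 1 fun P : Measure Ω => P :=
  ⟨_, fun P _ => measurePreserving_funUnique P (Fin 1)⟩

lemma Simulable.map {M : ℕ} {V : Measure Ω → Measure S} (h : Simulable M V) {f : S → S'}
    (hf : Measurable f) : Simulable M fun P => (V P).map f := by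
  obtain ⟨φ, hφ⟩ := h
  exact ⟨f ∘ φ, fun P _ => (hf.measurePreserving (V P)).comp (hφ P)⟩

lemma Simulable.prod {M M' : ℕ} {V : Measure Ω → Measure S} {V' : Measure Ω → Measure S'}
    (h : Simulable M V) (h' : Simulable M' V') :
    Simulable (M + M') fun P => (V P).prod (V' P) := by
  obtain ⟨φ, hφ⟩ := id h
  obtain ⟨φ', hφ'⟩ := id h'
  have hsum := simulable_card (V := fun P => (V P).prod (V' P)) (ι := Fin M ⊕ Fin M') _
    fun P _ =>
      have := h.isProbabilityMeasure P
      have := h'.isProbabilityMeasure P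
      ((hφ P).prod (hφ' P)).comp (measurePreserving_sumPiEquivProdPi fun _ => P)
  simpa only [Fintype.card_sum, Fintype.card_fin] using hsum

lemma measurePreserving_curry {ι κ : Type*} [Fintype ι] [Fintype κ] (P : Measure Ω)
    [SigmaFinite P] :
    MeasurePreserving (MeasurableEquiv.curry ι κ Ω) (Measure.pi fun _ => P)
      (Measure.pi fun _ => Measure.pi fun _ => P) := by
  refine MeasurePreserving.symm (MeasurableEquiv.curry ι κ Ω).symm
    ⟨(MeasurableEquiv.curry ι κ Ω).symm.measurable, (Measure.pi_eq fun s _ => ?_).symm⟩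
  have hbox : (MeasurableEquiv.curry ι κ Ω).symm ⁻¹' Set.univ.pi s =
      Set.univ.pi fun i => Set.univ.pi fun j => s (i, j) := by
    ext x
    simp [Set.mem_pi, MeasurableEquiv.coe_curry_symm]
  rw [MeasurableEquiv.map_apply, hbox]
  simp only [Measure.pi_pi, Fintype.prod_prod_type]

lemma Simulable.pi {M : ℕ} {V : Measure Ω → Measure S} (h : Simulable M V) (m : ℕ) :
    Simulable (m * M) fun P => Measure.pi fun _ : Fin m => V P := by
  obtain ⟨φ, hφ⟩ := id h
  have hprod := simulable_card (V := fun P => Measure.pi fun _ : Fin m => V P)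
    (ι := Fin m × Fin M) _ fun P _ =>
      have := h.isProbabilityMeasure P
      (measurePreserving_pi _ _ fun _ => hφ P).comp (measurePreserving_curry P)
  simpa only [Fintype.card_prod, Fintype.card_fin] using hprod

variable {X Y W : Type*} [MeasurableSpace X] [MeasurableSpace Y] [MeasurableSpace W]

lemma simulable_prodMarginals :
    Simulable 3 (prodMarginals : Measure (X × Y × W) → Measure (X × Y × W)) :=
  (simulable_id.map measurable_fst).prod
    (((simulable_id.map measurable_snd).map measurable_fst).prod
      ((simulable_id.map measurable_snd).map measurable_snd))

lemma simulable_batchLaw (m : ℕ) :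
    Simulable (9 * m) (batchLaw m : Measure (X × Y × W) → Measure (Batches m (X × Y × W))) := by
  have hpair := simulable_id.prod (simulable_prodMarginals (X := X) (Y := Y) (W := W))
  rw [show 9 * m = m * 1 + (m * (1 + 3) + m * (1 + 3)) by ring]
  exact (simulable_id.pi m).prod ((hpair.pi m).prod (hpair.pi m))

lemma exists_measureReal_preimage_eq_batchLaw [Finite X] [Finite Y] [Finite W]
    [MeasurableSingletonClass X] [MeasurableSingletonClass Y] [MeasurableSingletonClass W] (m : ℕ) :
    ∃ φ : (Fin (9 * m) → X × Y × W) → Batches m (X × Y × W),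
      ∀ (P : Measure (X × Y × W)) [IsProbabilityMeasure P] (E : Set (Batches m (X × Y × W))),
        (Measure.pi fun _ => P).real (φ ⁻¹' E) = (batchLaw m P).real E := by
  obtain ⟨φ, hφ⟩ := simulable_batchLaw (X := X) (Y := Y) (W := W) m
  exact ⟨φ, fun P _ E =>
    (hφ P).measureReal_preimage (Set.toFinite E).measurableSet.nullMeasurableSet⟩

end Simulable

section DeterministicTester

lemma Tester.prob_pure {Ω : Type*} [Fintype Ω] [MeasurableSpace Ω] [MeasurableSingletonClass Ω]
    {M : ℕ} (D : PMF Ω → (Fin M → Ω) → Answer) (phat p : PMF Ω) (o : Answer) :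
    Tester.prob (fun r s => PMF.pure (D r s)) phat p o =
      (Measure.pi fun _ => p.toMeasure).real {s | D phat s = o} := by
  classical
  have hpoint (s : Fin M → Ω) : (Measure.pi fun _ => p.toMeasure).real {s} =
      ∏ j, (p (s j)).toReal := by
    simp only [measureReal_def, Measure.pi_singleton, ENNReal.toReal_prod,
      PMF.toMeasure_apply_singleton _ _ (measurableSet_singleton _)]
  have hpure (s : Fin M → Ω) : (PMF.pure (D phat s) o).toReal = if D phat s = o then 1 else 0 := by
    simp only [PMF.pure_apply, eq_comm (a := o), apply_ite ENNReal.toReal, ENNReal.toReal_one,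
      ENNReal.toReal_zero]
  simp only [Tester.prob, hpure, ← hpoint, mul_ite, mul_one, mul_zero]
  rw [← Finset.sum_filter, sum_measureReal_singleton, Finset.coe_filter_univ]

end DeterministicTester

section BalancedIndex

open Finset

variable {ι : Type*} [Fintype ι] [LinearOrder ι] [LocallyFiniteOrderBot ι]

lemma prod_Iic_mul_prod_Ioi [LocallyFiniteOrderTop ι] {M : Type*} [CommMonoid M] (f : ι → M)
    (k : ι) : (∏ i ∈ Iic k, f i) * ∏ i ∈ Ioi k, f i = ∏ i, f i := by
  have hcompl : (Iic k)ᶜ = Ioi k := by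
    ext i
    simp only [mem_compl, mem_Iic, mem_Ioi, not_le]
  rw [← hcompl, prod_mul_prod_compl]

lemma exists_le_sq_prod_Iic [Nonempty ι] {f : ι → ℕ} (hf : ∀ i, 1 ≤ f i) :
    ∃ k, ∏ i, f i ≤ (∏ i ∈ Iic k, f i) ^ 2 ∧ (∏ i ∈ Iio k, f i) ^ 2 ≤ ∏ i, f i := by
  have hone : 1 ≤ ∏ i, f i := one_le_prod' fun i _ => hf i
  obtain ⟨t, ht⟩ := Finite.exists_max (id : ι → ι)
  have htop : Iic t = univ := eq_univ_of_forall fun i => mem_Iic.2 (ht i)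
  obtain ⟨k, hk, hmin⟩ := exists_minimal_of_wellFoundedLT
    (fun k => ∏ i, f i ≤ (∏ i ∈ Iic k, f i) ^ 2) ⟨t, htop ▸ Nat.le_self_pow two_ne_zero _⟩
  refine ⟨k, hk, ?_⟩
  by_contra! hlt
  have hne : (Iio k).Nonempty := by
    rw [nonempty_iff_ne_empty]
    intro hempty
    rw [hempty, prod_empty, one_pow] at hlt
    exact hone.not_gt hlt
  have hpred : Iic ((Iio k).max' hne) = Iio k := by
    ext i
    exact ⟨fun hi => mem_Iio.2 ((mem_Iic.1 hi).trans_lt (mem_Iio.1 (max'_mem _ hne))),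
      fun hi => mem_Iic.2 (le_max' _ _ hi)⟩
  have hpred_le : ∏ i, f i ≤ (∏ i ∈ Iic ((Iio k).max' hne), f i) ^ 2 := by
    rw [hpred]
    exact hlt.le
  have hpred_lt : (Iio k).max' hne < k := mem_Iio.1 (max'_mem _ hne)
  exact (hmin hpred_le hpred_lt.le).not_gt hpred_lt

lemma exists_balanced_index [LocallyFiniteOrderTop ι] [Nonempty ι] {f : ι → ℕ}
    (hf : ∀ i, 1 ≤ f i) :
    ∃ k, (∏ i ∈ Iio k, f i) ^ 2 ≤ ∏ i, f i ∧ (∏ i ∈ Ioi k, f i) ^ 2 ≤ ∏ i, f i := by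
  obtain ⟨k, hle, hleft⟩ := exists_le_sq_prod_Iic hf
  have hpos : 0 < ∏ i, f i := prod_pos fun i _ => hf i
  refine ⟨k, hleft, le_of_mul_le_mul_left (a := ∏ i, f i) ?_ hpos⟩
  calc (∏ i, f i) * (∏ i ∈ Ioi k, f i) ^ 2
      ≤ (∏ i ∈ Iic k, f i) ^ 2 * (∏ i ∈ Ioi k, f i) ^ 2 := by gcongr
    _ = (∏ i, f i) * ∏ i, f i := by rw [← mul_pow, prod_Iic_mul_prod_Ioi, sq]

end BalancedIndex

section Blocks

variable {d : ℕ} {n : Fin d → ℕ}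

/-- The coordinates before `k`. -/
abbrev LeftBlock (n : Fin d → ℕ) (k : Fin d) : Type := (i : {i // i < k}) → Fin (n i)

/-- The coordinates after `k`. -/
abbrev RightBlock (n : Fin d → ℕ) (k : Fin d) : Type := (i : {i // k < i}) → Fin (n i)

/-- Splitting the domain into the coordinates before, at and after `k`. -/
def blockEquiv (n : Fin d → ℕ) (k : Fin d) :
    Domain n ≃ LeftBlock n k × Fin (n k) × RightBlock n k where
  toFun x := (fun i => x i, x k, fun i => x i)
  invFun z i :=
    if hlt : i < k then z.1 ⟨i, hlt⟩
    else if hgt : k < i then z.2.2 ⟨i, hgt⟩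
    else Fin.cast (congrArg n (le_antisymm (not_lt.1 hlt) (not_lt.1 hgt))) z.2.1
  left_inv x := by
    funext i
    obtain hlt | rfl | hgt := lt_trichotomy i k
    · simp [hlt]
    · simp
    · simp [hgt, hgt.not_gt]
  right_inv z := by
    refine Prod.ext ?_ (Prod.ext ?_ ?_)
    · funext i
      simp [i.2]
    · simp
    · funext i
      simp [i.2, i.2.le]

lemma prod_blocks {M : Type*} [CommMonoid M] (f : Fin d → M) (k : Fin d) :
    (∏ i : {i // i < k}, f i) * (f k * ∏ i : {i // k < i}, f i) = ∏ i, f i := by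
  rw [← Finset.prod_subtype (Finset.Iio k) (fun _ => Finset.mem_Iio) f,
    ← Finset.prod_subtype (Finset.Ioi k) (fun _ => Finset.mem_Ioi) f, ← mul_assoc,
    Finset.prod_Iio_mul_eq_prod_Iic, prod_Iic_mul_prod_Ioi]

lemma card_blocks (n : Fin d → ℕ) (k : Fin d) :
    Fintype.card (LeftBlock n k × Fin (n k) × RightBlock n k) = ∏ i, n i := by
  simp only [← prod_blocks n k, Fintype.card_prod, Fintype.card_pi, Fintype.card_fin]

lemma exists_card_blocks_le (hn : ∀ i, 1 ≤ n i) [NeZero d] :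
    ∃ k, Fintype.card (LeftBlock n k) ^ 2 ≤ ∏ i, n i ∧
      Fintype.card (RightBlock n k) ^ 2 ≤ ∏ i, n i := by
  obtain ⟨k, hleft, hright⟩ := exists_balanced_index hn
  refine ⟨k, ?_⟩
  simp only [Fintype.card_pi, Fintype.card_fin]
  rw [← Finset.prod_subtype (Finset.Iio k) (fun _ => Finset.mem_Iio) n,
    ← Finset.prod_subtype (Finset.Ioi k) (fun _ => Finset.mem_Ioi) n]
  exact ⟨hleft, hright⟩

lemma map_pi_blockEquiv (ν : (i : Fin d) → Measure (Fin (n i))) [∀ i, IsProbabilityMeasure (ν i)]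
    (k : Fin d) :
    (Measure.pi ν).map (blockEquiv n k) =
      (Measure.pi fun i : {i // i < k} => ν i).prod
        ((ν k).prod (Measure.pi fun i : {i // k < i} => ν i)) := by
  refine Measure.ext_of_singleton fun z => ?_
  obtain ⟨x, rfl⟩ := (blockEquiv n k).surjective z
  have hpre : blockEquiv n k ⁻¹' {blockEquiv n k x} = {x} := by
    rw [← Set.image_singleton, Equiv.preimage_image]
  have hsplit : ({blockEquiv n k x} : Set _) =
      {fun i : {i // i < k} => x i} ×ˢ ({x k} ×ˢ {fun i : {i // k < i} => x i}) := by
    simp only [Set.singleton_prod_singleton, blockEquiv, Equiv.coe_fn_mk]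
  rw [Measure.map_apply .of_discrete (measurableSet_singleton _), hpre, hsplit, Measure.prod_prod,
    Measure.prod_prod, Measure.pi_singleton, Measure.pi_singleton, Measure.pi_singleton,
    ← prod_blocks _ k]

/-- The product distributions on the coordinates satisfying `S`. -/
def productLaws (n : Fin d → ℕ) (S : Fin d → Prop) [DecidablePred S] :
    Set (Measure ((i : {i // S i}) → Fin (n i))) :=
  Set.range fun q : (i : Fin d) → PMF (Fin (n i)) =>
    Measure.pi fun i : {i // S i} => (q i).toMeasure

/-- The joint law of the three blocks. -/
noncomputable def blockLaw (k : Fin d) (p : PMF (Domain n)) :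
    Measure (LeftBlock n k × Fin (n k) × RightBlock n k) :=
  p.toMeasure.map (blockEquiv n k)

instance (k : Fin d) (p : PMF (Domain n)) : IsProbabilityMeasure (blockLaw k p) :=
  Measure.isProbabilityMeasure_map Measurable.of_discrete.aemeasurable

lemma tv_blockLaw (k : Fin d) (p q : PMF (Domain n)) :
    tv (blockLaw k p) (blockLaw k q) = tvDist p q := by
  rw [tvDist_eq_tv]
  refine (tv_map_le _ _ _).antisymm ?_
  have hle := tv_map_le (blockLaw k p) (blockLaw k q) (blockEquiv n k).symm
  simpa only [blockLaw, Measure.map_map .of_discrete .of_discrete, Equiv.symm_comp_self,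
    Measure.map_id] using hle

lemma isProduct_iff_toMeasure_eq_pi {p : PMF (Domain n)} :
    IsProduct p ↔ ∃ q : (i : Fin d) → PMF (Fin (n i)),
      p.toMeasure = Measure.pi fun i => (q i).toMeasure := by
  refine exists_congr fun q => ⟨fun hq => Measure.ext_of_singleton fun x => ?_, fun hq x => ?_⟩
  · rw [Measure.pi_singleton]
    simp only [PMF.toMeasure_apply_singleton _ _ (measurableSet_singleton _), hq]
  · rw [← p.toMeasure_apply_singleton x (measurableSet_singleton _), hq, Measure.pi_singleton]
    simp only [PMF.toMeasure_apply_singleton _ _ (measurableSet_singleton _)]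

end Blocks

section BlockLaw

variable {d : ℕ} {n : Fin d → ℕ}

lemma IsProduct.blockLaw_eq {p : PMF (Domain n)} (hp : IsProduct p) (k : Fin d) :
    blockLaw k p = prodMarginals (blockLaw k p) ∧
      (blockLaw k p).fst ∈ productLaws n (· < k) ∧
      (blockLaw k p).snd.snd ∈ productLaws n (k < ·) := by
  obtain ⟨q, hq⟩ := isProduct_iff_toMeasure_eq_pi.1 hp
  rw [blockLaw, hq, map_pi_blockEquiv]
  simp only [prodMarginals, Measure.fst_prod, Measure.snd_prod, productLaws, Set.mem_range_self,
    and_self]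

lemma exists_isProduct_map_blockEquiv (k : Fin d) {μ : Measure (LeftBlock n k)}
    {ν : Measure (RightBlock n k)} (hμ : μ ∈ productLaws n (· < k))
    (hν : ν ∈ productLaws n (k < ·)) (ρ : Measure (Fin (n k))) [IsProbabilityMeasure ρ] :
    ∃ p : PMF (Domain n), IsProduct p ∧ blockLaw k p = μ.prod (ρ.prod ν) := by
  obtain ⟨q, rfl⟩ := hμ
  obtain ⟨q', rfl⟩ := hν
  let c : (i : Fin d) → PMF (Fin (n i)) := fun i =>
    if i < k then q i else if k < i then q' i else (Function.update q k ρ.toPMF) i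
  have hc : (Measure.pi fun i => (c i).toMeasure).toPMF.toMeasure =
      Measure.pi fun i => (c i).toMeasure := Measure.toPMF_toMeasure _
  refine ⟨_, isProduct_iff_toMeasure_eq_pi.2 ⟨c, hc⟩, ?_⟩
  have hleft (i : {i // i < k}) : c i = q i := if_pos i.2
  have hmid : (c k).toMeasure = ρ := by
    simp only [c, lt_irrefl, if_false, Function.update_self, Measure.toPMF_toMeasure]
  have hright (i : {i // k < i}) : c i = q' i := by
    simp only [c, i.2, i.2.not_gt, if_false, if_true]
  rw [blockLaw, hc, map_pi_blockEquiv]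
  simp only [hleft, hmid, hright]

lemma IsFarFromProduct.blockLaw_far {ε : ℝ} {p : PMF (Domain n)} (hp : IsFarFromProduct ε p)
    (k : Fin d) :
    ε / 2 ≤ tv (blockLaw k p) (prodMarginals (blockLaw k p)) ∨
      (∀ a ∈ productLaws n (· < k), ε / 4 ≤ tv (blockLaw k p).fst a) ∨
      ∀ b ∈ productLaws n (k < ·), ε / 4 ≤ tv (blockLaw k p).snd.snd b := by
  by_contra! hclose
  obtain ⟨hdist, ⟨a, ha, hleft⟩, b, hb, hright⟩ := hclose
  have : IsProbabilityMeasure a := by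
    obtain ⟨q, rfl⟩ := ha
    infer_instance
  have : IsProbabilityMeasure b := by
    obtain ⟨q, rfl⟩ := hb
    infer_instance
  obtain ⟨p', hp', hlaw⟩ := exists_isProduct_map_blockEquiv k ha hb (blockLaw k p).snd.fst
  set P := blockLaw k p with hP
  have hprod : tv (prodMarginals P) (blockLaw k p') ≤ tv P.fst a + tv P.snd.snd b := by
    rw [hlaw, prodMarginals]
    refine (tv_prod_le _ _ _ _).trans (add_le_add_right ((tv_prod_le _ _ _ _).trans_eq ?_) _)
    rw [tv_self, zero_add]
  have hfar : ε ≤ tv P (blockLaw k p') := by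
    rw [hP, tv_blockLaw]
    exact hp p' hp'
  linarith [tv_triangle P (prodMarginals P) (blockLaw k p')]

lemma EnoughSamples.exists_tester {k : Fin d} {m : ℕ} [NeZero m] {α ε : ℝ}
    (h : EnoughSamples (LeftBlock n k) (Fin (n k)) (RightBlock n k) m α ε) :
    ∃ A : Tester (9 * m) (Domain n), IsAugmentedIndependenceTester α ε 0.1 A := by
  obtain ⟨φ, hφ⟩ := exists_measureReal_preimage_eq_batchLaw
    (X := LeftBlock n k) (Y := Fin (n k)) (W := RightBlock n k) m
  let answer (r : PMF (Domain n)) :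
      Batches m (LeftBlock n k × Fin (n k) × RightBlock n k) → Answer :=
    blockTester α ε (productLaws n (· < k)) (productLaws n (k < ·)) (blockLaw k r)
  let A : Tester (9 * m) (Domain n) := fun r s => PMF.pure (answer r (φ (blockEquiv n k ∘ s)))
  have hA (r p : PMF (Domain n)) (o : Answer) :
      A.prob r p o = (batchLaw m (blockLaw k p)).real {t | answer r t = o} := by
    have hblock : MeasurePreserving (blockEquiv n k) p.toMeasure (blockLaw k p) :=
      Measurable.of_discrete.measurePreserving _
    rw [← hφ, Tester.prob_pure fun r s => answer r (φ (blockEquiv n k ∘ s))]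
    exact (measurePreserving_pi _ _ fun _ => hblock).measureReal_preimage
      (Set.toFinite (φ ⁻¹' {t | answer r t = o})).measurableSet.nullMeasurableSet
  have hδ : (0.1 : ℝ) / 2 = 1 / 20 := by norm_num
  refine ⟨A, fun p r hα => ?_, fun p r hfar => ?_, fun p r hp => ?_⟩ <;>
    rw [hA, hδ]
  · exact h.blockTester_accurate ((tv_blockLaw k p r).trans_le hα) _ _
  · exact h.blockTester_far (hfar.blockLaw_far k)
  · obtain ⟨hind, hleft, hright⟩ := hp.blockLaw_eq k
    exact h.blockTester_product hind hleft hright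

end BlockLaw

section SampleSize

lemma le_sq_mul_of_sqrt_div_le {N ε B : ℝ} (hN : 0 ≤ N) (hε : 0 < ε) (h : √N / ε ^ 2 ≤ B) :
    N ≤ B ^ 2 * ε ^ 4 := by
  have hsqrt : √N ≤ B * ε ^ 2 := (div_le_iff₀ (pow_pos hε 2)).1 h
  calc N = √N ^ 2 := (Real.sq_sqrt hN).symm
    _ ≤ (B * ε ^ 2) ^ 2 := by gcongr
    _ = B ^ 2 * ε ^ 4 := by ring

lemma cube_rpow_third {x : ℝ} (hx : 0 ≤ x) (a : ℝ) : (x ^ (a / 3)) ^ 3 = x ^ a := by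
  rw [← Real.rpow_natCast, ← Real.rpow_mul hx]
  norm_num

lemma mul_le_cube_mul_of_rpow_div_le {a b c ε B : ℝ} (ha : 0 ≤ a) (hb : 0 ≤ b) (hc : 0 ≤ c)
    (hε : 0 < ε)
    (h : a ^ (1 / 3 : ℝ) * b ^ (1 / 3 : ℝ) * c ^ (1 / 3 : ℝ) / ε ^ (4 / 3 : ℝ) ≤ B) :
    a * b * c ≤ B ^ 3 * ε ^ 4 := by
  have hroots := (div_le_iff₀ (Real.rpow_pos_of_pos hε _)).1 h
  have hcube : (a ^ (1 / 3 : ℝ) * b ^ (1 / 3 : ℝ) * c ^ (1 / 3 : ℝ)) ^ 3 ≤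
      (B * ε ^ (4 / 3 : ℝ)) ^ 3 := by
    gcongr
  simpa only [mul_pow, cube_rpow_third ha, cube_rpow_third hb, cube_rpow_third hc,
    cube_rpow_third hε.le, Real.rpow_one, Real.rpow_ofNat] using hcube

lemma enoughSamples_of_le {X Y W : Type*} [Fintype X] [Fintype Y] [Fintype W] {m : ℕ}
    {N n₁ α ε B : ℝ} (hN : N = Fintype.card (X × Y × W)) (hY : Fintype.card Y ≤ n₁)
    (hX : Fintype.card X ^ 2 ≤ Fintype.card (X × Y × W))
    (hW : Fintype.card W ^ 2 ≤ Fintype.card (X × Y × W)) (hε : 0 < ε) (hε1 : ε ≤ 1) (hα : 0 ≤ α)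
    (hm : 10 ^ 10 * B ≤ m) (hsqrt : √N / ε ^ 2 ≤ B)
    (hcbrt : n₁ ^ (1 / 3 : ℝ) * N ^ (1 / 3 : ℝ) * α ^ (1 / 3 : ℝ) / ε ^ (4 / 3 : ℝ) ≤ B) :
    EnoughSamples X Y W m α ε := by
  have hn₁ : 0 ≤ n₁ := (Nat.cast_nonneg _).trans hY
  have hN0 : 0 ≤ N := hN ▸ Nat.cast_nonneg _
  have hB : 0 ≤ B := (by positivity : 0 ≤ √N / ε ^ 2).trans hsqrt
  refine ⟨hε, hε1, hα, by exact_mod_cast hX, by exact_mod_cast hW, ?_, ?_⟩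
  · calc _ = (10 ^ 10) ^ 2 * N := by rw [hN]; norm_num
      _ ≤ (10 ^ 10) ^ 2 * (B ^ 2 * ε ^ 4) := by gcongr; exact le_sq_mul_of_sqrt_div_le hN0 hε hsqrt
      _ = (10 ^ 10 * B) ^ 2 * ε ^ 4 := by ring
      _ ≤ (m : ℝ) ^ 2 * ε ^ 4 := by gcongr
  · calc _ ≤ 10 ^ 20 * (n₁ * N * α) := by rw [hN]; gcongr
      _ ≤ 10 ^ 30 * (B ^ 3 * ε ^ 4) := by
        gcongr ?_ * ?_
        · norm_num
        · exact mul_le_cube_mul_of_rpow_div_le hn₁ hN0 hα hε hcbrt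
      _ = (10 ^ 10 * B) ^ 3 * ε ^ 4 := by ring
      _ ≤ (m : ℝ) ^ 3 * ε ^ 4 := by gcongr

end SampleSize

end AugIndep

theorem theorem4_general {d : ℕ} {n : Fin d → ℕ} (hn : ∀ i, 1 ≤ n i) {j : Fin d}
    (hj : ∀ i, n i ≤ n j) {ε : ℝ} (hε : 0 < ε) (hε1 : ε ≤ 1) {α : ℝ} (hα : 0 ≤ α) :
    ∃ (m : ℕ) (A : AugIndep.Tester m (AugIndep.Domain n)),
      AugIndep.IsAugmentedIndependenceTester α ε 0.1 A ∧
      (m : ℝ) ≤ 10 ^ 11 * max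
        (√(∏ i, (n i : ℝ)) / ε ^ 2)
        ((n j : ℝ) ^ (1 / 3 : ℝ) * (∏ i, (n i : ℝ)) ^ (1 / 3 : ℝ) * α ^ (1 / 3 : ℝ)
          / ε ^ (4 / 3 : ℝ)) := by
  set B := max (√(∏ i, (n i : ℝ)) / ε ^ 2) _
  have hN : (1 : ℝ) ≤ ∏ i, (n i : ℝ) := by
    exact_mod_cast Finset.one_le_prod' fun i _ => hn i
  have hB : 1 ≤ B := le_max_of_le_left <|
    (one_le_div₀ (by positivity)).2 ((pow_le_one₀ hε.le hε1).trans (Real.one_le_sqrt.2 hN))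
  have : NeZero d := ⟨j.pos.ne'⟩
  obtain ⟨k, hleft, hright⟩ := AugIndep.exists_card_blocks_le hn
  have : NeZero ⌈10 ^ 10 * B⌉₊ := ⟨(Nat.ceil_pos.2 (by positivity)).ne'⟩
  have hcard := AugIndep.card_blocks n k
  have henough := AugIndep.enoughSamples_of_le (n₁ := n j) (B := B) (by rw [hcard, Nat.cast_prod])
    (by simpa only [Fintype.card_fin, Nat.cast_le] using hj k) (hcard ▸ hleft) (hcard ▸ hright)
    hε hε1 hα (Nat.le_ceil _) (le_max_left _ _) (le_max_right _ _)
  obtain ⟨A, hA⟩ := henough.exists_tester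
  refine ⟨_, A, hA, ?_⟩
  have hceil := (Nat.ceil_lt_add_one (by positivity : 0 ≤ 10 ^ 10 * B)).le
  push_cast
  linarith

theorem theorem4 :
    ∃ C : ℝ, ∀ (d : ℕ) (hd : 1 ≤ d) (n : Fin d → ℕ), Antitone n → (∀ i, 2 ≤ n i) →
      ∀ ε : ℝ, 0 < ε → ε < 1 → ∀ α : ℝ, 0 ≤ α → α ≤ 1 →
        ∃ (m : ℕ) (A : AugIndep.Tester m (AugIndep.Domain n)),
          AugIndep.IsAugmentedIndependenceTester α ε 0.1 A ∧
          (m : ℝ) ≤ C * max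
            (Real.sqrt (∏ i, (n i : ℝ)) / ε ^ 2)
            ((n ⟨0, hd⟩ : ℝ) ^ (1 / 3 : ℝ) * (∏ i, (n i : ℝ)) ^ (1 / 3 : ℝ) * α ^ (1 / 3 : ℝ)
              / ε ^ (4 / 3 : ℝ)) :=
  ⟨10 ^ 11, fun _ _ _ hanti hn _ hε hε1 _ hα _ => theorem4_general
    (fun i => one_le_two.trans (hn i)) (fun _ => hanti (Fin.le_def.2 (Nat.zero_le _))) hε hε1.le hα⟩
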